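/- Let $B$ be a commutative Noetherian ring whose elements are coded by natural numbers. Assume that $B$ is *computable*, i.e. addition, negation and multiplication of $B$ are computable and there is an algorithm which, given matrices $A$ and $C$ over $B$, decides whether $XA=C$ is solvable and, if so, finds an affine generating set of all solutions $X$. Assume also that $B$ has *effective coset representatives*, i.e. every ideal $I\subseteq B$ has a set $T_I$ of coset representatives of $B/I$, and there is an algorithm which, given generators of $I$ and $b\in B$, computes the unique $t\in T_I$ with $b+I=t+I$. Let $n\ge 0$ and let $S=B[x_0,\ldots,x_n]$ be $\mathbb{Z}$-graded by $\deg x_i=1$ and $\deg b=0$ for $b\in B\setminus\{0\}$. Call a $\mathbb{Z}$-graded $S$-module $M=\bigoplus_d M_d$ *quasi-zero* if $M_d=0$ for all $d\gg 0$. Then there is an algorithm which decides whether a finitely presented graded $S$-module $M$, given by the degrees of finitely many homogeneous generators and a finite matrix of homogeneous relations, is quasi-zero. More precisely, $M$ is quasi-zero if and only if the dehomogenized module $(M_{x_i})_0$ (the degree-zero part of the localization of $M$ at the powers of $x_i$) vanishes for every $0\le i\le n$. There is an algorithm which, given $i$ and a presentation of $M$ as above, decides whether $(M_{x_i})_0=0$;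 the algorithm for quasi-zero modules returns "yes" exactly if this one does so for all $i$. -/

import Mathlib

/-! Computability is that of `Mathlib.Computability`: an algorithm is a recursive function
(`Computable`) on types whose elements are coded by natural numbers (`Primcodable`). -/

/-- The `p × q` matrix with the given list of rows; missing entries are `0`. -/
def matrixOfRows {B : Type*} [Zero B] (p q : ℕ) (rows : List (List B)) :
    Matrix (Fin p) (Fin q) B :=
  Matrix.of fun i j => (rows.getD i []).getD j 0

/-- Input of a linear system `X * A = C`: sizes `p, q, r` and the rows of the `p × q` matrix `A`
and of the `r × q` matrix `C`. -/
abbrev LinearSystem (B : Type*) : Type _ :=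
  (ℕ × ℕ × ℕ) × List (List B) × List (List B)

/-- The set of all `r × p` matrices `X` with `X * A = C`. -/
def LinearSystem.solutions {B : Type*} [CommRing B] (s : LinearSystem B) :
    Set (Matrix (Fin s.1.2.2) (Fin s.1.1) B) :=
  {X | X * matrixOfRows s.1.1 s.1.2.1 s.2.1 = matrixOfRows s.1.2.2 s.1.2.1 s.2.2}

/-- The affine space `X₀ + ⟨H₁, …, H_k⟩` of `r × p` matrices given by a pair
`(X₀, [H₁, …, H_k])`. -/
def affineSpaceOf {B : Type*} [CommRing B] (r p : ℕ)
    (a : List (List B) × List (List (List B))) : Set (Matrix (Fin r) (Fin p) B) :=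
  {X | X - matrixOfRows r p a.1 ∈
    Submodule.span B {H | ∃ rows ∈ a.2, H = matrixOfRows r p rows}}

/-- A commutative ring whose elements are coded by natural numbers is computable if its arithmetic
is and if there is an algorithm which, given matrices `A` and `C`, decides whether `X * A = C` is
solvable and, if so, finds an affine generating set of all solutions `X`. -/
structure IsComputableRing (B : Type*) [CommRing B] [Primcodable B] : Prop where
  add : Computable₂ fun a b : B => a + b
  neg : Computable fun a : B => -a
  mul : Computable₂ fun a b : B => a * b
  solve : ∃ solve : LinearSystem B → Option (List (List B) × List (List (List B))),
    Computable solve ∧ ∀ s : LinearSystem B,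
      (solve s = none → s.solutions = ∅) ∧
      ∀ a, solve s = some a → s.solutions = affineSpaceOf s.1.2.2 s.1.1 a

/-- The ideal generated by the entries of a list. -/
def idealOfList {B : Type*} [CommRing B] (L : List B) : Ideal B :=
  Ideal.span {b | b ∈ L}

/-- Every ideal `I` has a set `T I` of coset representatives of `B / I`, and there is an algorithm
which, given generators of `I` and `b : B`, computes the unique `t ∈ T I` with `b + I = t + I`. -/
def HasEffectiveCosetReps (B : Type*) [CommRing B] [Primcodable B] : Prop :=
  ∃ (T : Ideal B → Set B) (rep : List B → B → B),
    (∀ (I : Ideal B) (b : B), ∃! t, t ∈ T I ∧ b - t ∈ I) ∧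
    Computable₂ rep ∧
    ∀ (L : List B) (b : B), rep L b ∈ T (idealOfList L) ∧ b - rep L b ∈ idealOfList L

/-- A polynomial in `x₀, …, xₙ` given by a list of coefficients with exponent vectors. -/
abbrev PolyCode (B : Type*) (n : ℕ) : Type _ := List (B × (Fin (n + 1) → ℕ))

/-- The polynomial given by a list of terms (the sum of these terms). -/
noncomputable def PolyCode.toPoly {B : Type*} [CommRing B] {n : ℕ} (l : PolyCode B n) :
    MvPolynomial (Fin (n + 1)) B :=
  (l.map fun t => MvPolynomial.monomial (Finsupp.equivFunOnFinite.symm t.2) t.1).sum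

/-- The data of a finite graded presentation over `B[x₀, …, xₙ]`: the list of the degrees of the
generators and the list of the rows of the presentation matrix. -/
abbrev PresentationCode (B : Type*) (n : ℕ) : Type _ := List ℤ × List (List (PolyCode B n))

namespace PresentationCode

/-- The degree of the `j`-th generator. -/
def deg {B : Type*} {n : ℕ} (c : PresentationCode B n) (j : Fin c.1.length) : ℤ := c.1.get j

/-- The presentation matrix; each row is a relation, and missing entries are `0`. -/
noncomputable def mat {B : Type*} [CommRing B] {n : ℕ} (c : PresentationCode B n) :
    Matrix (Fin c.2.length) (Fin c.1.length) (MvPolynomial (Fin (n + 1)) B) :=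
  Matrix.of fun r j => PolyCode.toPoly ((c.2.get r).getD j [])

/-- Each row of the matrix is a homogeneous relation, of some degree `e`, between generators
of the given degrees. -/
def IsHomogeneous {B : Type*} [CommRing B] {n : ℕ} (c : PresentationCode B n) : Prop :=
  ∀ r, ∃ e : ℤ, ∀ j, c.mat r j = 0 ∨
    ∃ k : ℕ, (c.mat r j).IsHomogeneous k ∧ c.deg j + k = e

end PresentationCode

/-- `M = ⨁_d M_d` is a `ℤ`-graded module over `B[x₀, …, xₙ]` with its standard grading. -/
structure IsGradedModule {B : Type*} [CommRing B] {n : ℕ} {M : Type*} [AddCommGroup M]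
    [Module (MvPolynomial (Fin (n + 1)) B) M] (ℳ : ℤ → AddSubgroup M) : Prop where
  isInternal : DirectSum.IsInternal ℳ
  smul_mem : ∀ (k : ℕ) (f : MvPolynomial (Fin (n + 1)) B) (d : ℤ) (m : M),
    f.IsHomogeneous k → m ∈ ℳ d → f • m ∈ ℳ (d + k)

/-- The graded module `M` is presented by `c`: it has homogeneous generators of the given degrees
whose module of relations is generated by the rows of the (homogeneous) matrix. -/
def IsPresentedBy {B : Type*} [CommRing B] {n : ℕ} {M : Type*} [AddCommGroup M]
    [Module (MvPolynomial (Fin (n + 1)) B) M] (ℳ : ℤ → AddSubgroup M)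
    (c : PresentationCode B n) : Prop :=
  c.IsHomogeneous ∧ ∃ g : Fin c.1.length → M,
    (∀ j, g j ∈ ℳ (c.deg j)) ∧
    Submodule.span (MvPolynomial (Fin (n + 1)) B) (Set.range g) = ⊤ ∧
    ∀ v : Fin c.1.length → MvPolynomial (Fin (n + 1)) B,
      ∑ j, v j • g j = 0 ↔
        v ∈ Submodule.span (MvPolynomial (Fin (n + 1)) B) (Set.range c.mat)

/-- `M_d = 0` for `d ≫ 0`. -/
def IsQuasiZero {M : Type*} [AddCommGroup M] (ℳ : ℤ → AddSubgroup M) : Prop :=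
  ∃ d₀ : ℤ, ∀ d ≥ d₀, ℳ d = ⊥

/-- The restriction `(M_{xᵢ})₀` of `M` to the `i`-th standard affine chart: the degree-zero part
of the localization of `M` at the powers of `xᵢ`, i.e. the fractions `m / xᵢᵏ` with `m ∈ M_k`. -/
def chart {B : Type*} [CommRing B] {n : ℕ} {M : Type*} [AddCommGroup M]
    [Module (MvPolynomial (Fin (n + 1)) B) M] {ℳ : ℤ → AddSubgroup M}
    (h : IsGradedModule (B := B) (n := n) ℳ) (i : Fin (n + 1)) :
    AddSubgroup (LocalizedModule
      (Submonoid.powers (MvPolynomial.X i : MvPolynomial (Fin (n + 1)) B)) M) where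
  carrier := {z | ∃ (k : ℕ) (m : M), m ∈ ℳ k ∧
    z = LocalizedModule.mk m ⟨MvPolynomial.X i ^ k, Submonoid.pow_mem _ (Submonoid.mem_powers _) k⟩}
  zero_mem' := ⟨0, 0, (ℳ _).zero_mem, by rw [LocalizedModule.zero_mk]⟩
  add_mem' := by
    rintro _ _ ⟨k, m, hm, rfl⟩ ⟨l, m', hm', rfl⟩
    refine ⟨k + l, (MvPolynomial.X i : MvPolynomial (Fin (n + 1)) B) ^ l • m +
      (MvPolynomial.X i : MvPolynomial (Fin (n + 1)) B) ^ k • m', ?_, ?_⟩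
    · have h1 := h.smul_mem l _ k m (MvPolynomial.isHomogeneous_X_pow i l) hm
      have h2 := h.smul_mem k _ l m' (MvPolynomial.isHomogeneous_X_pow i k) hm'
      rw [add_comm (l : ℤ)] at h2
      push_cast
      exact (ℳ _).add_mem h1 h2
    · rw [LocalizedModule.mk_add_mk]
      congr 1
      exact Subtype.ext (pow_add _ k l).symm
  neg_mem' := by
    rintro _ ⟨k, m, hm, rfl⟩
    exact ⟨k, -m, (ℳ _).neg_mem hm, LocalizedModule.mk_neg.symm⟩

/-! Let `M` have homogeneous generators `e_j` and relation matrix `R`. As the `e_j` generate,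
`(M_{x_i})_0 = 0` exactly if some power of `x_i` kills every `e_j` (`chart_eq_bot_iff`), and by the
pigeonhole principle on exponents `M` is quasi-zero exactly if this holds for all `i`
(`isQuasiZero_iff`). So it suffices to decide, for one `i`, whether `x_i` acts nilpotently on the
cokernel of `R`.

A positive answer is found by searching for `N` and a matrix `X` with `X R = x_i ^ N`
(`exists_powerTest_iff`). The point is that a negative answer also has a finite certificate,
checkable by linear algebra over `B`; two parallel searches then decide.

The certificate (`IsNonvanishingCertificate`) is a map from the cokernel to a `B`-algebra `S / J`
that is finite and free over `B / I`: here `J` is generated by `I` and monic `g_k(x_k)`, with `g_i =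
x_i - s` and `s` a nonzerodivisor modulo `I`. In `S / J` the variable `x_i` acts as `s`, hence
injectively, so no power of it kills a generator with nonzero image.

Certificates exist whenever `x_i` is not nilpotent. The dehomogenized cokernel (`x_i = 1`) is then
nonzero, so it maps onto some `S / 𝔫` with `𝔫` maximal. By Zariski's lemma the coordinates become
integral over `B` in `S / 𝔫` after multiplication by some `s` outside `𝔫`; homogeneity allows the
same rescaling of the map, which replaces `𝔫` by a prime `𝔮` over `J`. By incomparability `𝔮` is
minimal over `J`, hence associated: `𝔮 = (J : c)`. Multiplication by `c` embeds `S / 𝔮` into `S / J`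
and gives the desired map (`exists_isNonvanishingCertificate`). -/

section Computability

/-! ### Closure properties of computable functions, and unbounded search. -/

variable {α β σ ι : Type*} [Primcodable α] [Primcodable β] [Primcodable σ]

theorem Computable.list_range_flatMap {N : α → ℕ} {f : α → ℕ → List β} (hN : Computable N)
    (hf : Computable₂ f) : Computable fun a => (List.range (N a)).flatMap (f a) := by
  have h : Computable fun a => (Nat.rec [] (fun k l => l ++ f a k) (N a) : List β) :=
    Computable.nat_rec hN (Computable.const [])
      (Computable.list_append.comp (Computable.snd.comp Computable.snd)
        (hf.comp Computable.fst (Computable.fst.comp Computable.snd))).to₂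
  refine h.of_eq fun a => ?_
  induction N a with
  | zero => rfl
  | succ k ih => simp [List.range_succ, ih]

theorem Computable.list_range_all {N : α → ℕ} {f : α → ℕ → Bool} (hN : Computable N)
    (hf : Computable₂ f) : Computable fun a => (List.range (N a)).all (f a) := by
  have h : Computable fun a => (Nat.rec true (fun k l => l && f a k) (N a) : Bool) :=
    Computable.nat_rec hN (Computable.const true)
      (Primrec.and.to_comp.comp (Computable.snd.comp Computable.snd)
        (hf.comp Computable.fst (Computable.fst.comp Computable.snd))).to₂
  refine h.of_eq fun a => ?_
  induction N a with
  | zero => rfl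
  | succ k ih => simp [List.range_succ, ih]

theorem Computable.list_range_map_sum [AddCommMonoid β] (hadd : Computable₂ fun a b : β => a + b)
    {N : α → ℕ} {f : α → ℕ → β} (hN : Computable N) (hf : Computable₂ f) :
    Computable fun a => ((List.range (N a)).map (f a)).sum := by
  have h : Computable fun a => (Nat.rec 0 (fun k l => l + f a k) (N a) : β) :=
    Computable.nat_rec hN (Computable.const 0)
      (hadd.comp (Computable.snd.comp Computable.snd)
        (hf.comp Computable.fst (Computable.fst.comp Computable.snd))).to₂
  refine h.of_eq fun a => ?_
  induction N a with
  | zero => rfl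
  | succ k ih => simp [List.range_succ, ih]

/-- The recursion runs over positions in the list, which reduces it to a range; a position out of
range would contribute `[]`. -/
theorem Computable.list_flatMap {l : α → List β} {f : α → β → List σ} (hl : Computable l)
    (hf : Computable₂ f) : Computable fun a => (l a).flatMap (f a) := by
  have h : Computable₂ fun a k => (Option.casesOn (l a)[k]? [] (f a) : List σ) :=
    (Computable.option_casesOn (Computable.list_getElem?.comp (hl.comp Computable.fst) Computable.snd)
      (Computable.const []) (hf.comp (Computable.fst.comp Computable.fst) Computable.snd).to₂).to₂
  refine (Computable.list_range_flatMap (Computable.list_length.comp hl) h).of_eq fun a => ?_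
  induction l a using List.reverseRecOn with
  | nil => rfl
  | append_singleton L b ih =>
    rw [List.length_append, List.length_singleton, List.range_succ, List.flatMap_append,
      List.flatMap_append, ← ih]
    congr 1
    · exact List.flatMap_congr fun k hk => by
        rw [List.getElem?_append_left (List.mem_range.1 hk)]
    · simp

theorem Computable.list_map {l : α → List β} {f : α → β → σ} (hl : Computable l)
    (hf : Computable₂ f) : Computable fun a => (l a).map (f a) :=
  (Computable.list_flatMap hl
    (Computable.list_cons.comp hf (Computable.const [])).to₂).of_eq
    fun a => by rw [← List.map_eq_flatMap]

theorem Computable.list_all {l : α → List β} {f : α → β → Bool} (hl : Computable l)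
    (hf : Computable₂ f) : Computable fun a => (l a).all (f a) := by
  have h := Computable.list_map hl hf
  refine (Computable.list_range_all (Computable.list_length.comp h)
    ((Primrec.list_getD true).to_comp.comp (h.comp Computable.fst) Computable.snd).to₂).of_eq
    fun a => ?_
  rw [Bool.eq_iff_iff]
  simp only [List.all_eq_true, List.mem_range, List.length_map]
  constructor
  · intro H b hb
    obtain ⟨k, hk, rfl⟩ := List.getElem_of_mem hb
    simpa [hk] using H k hk
  · intro H k hk
    simpa [hk] using H _ (List.getElem_mem hk)

theorem Computable.list_sum [AddCommMonoid β] (hadd : Computable₂ fun a b : β => a + b)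
    {l : α → List β} (hl : Computable l) : Computable fun a => (l a).sum := by
  refine (Computable.list_range_map_sum hadd (Computable.list_length.comp hl)
    ((Primrec.list_getD 0).to_comp.comp (hl.comp Computable.fst) Computable.snd).to₂).of_eq
    fun a => ?_
  congr 1
  refine List.ext_getElem (by simp) fun k _ hk => ?_
  simp [hk]

/-- As `L` is fixed, induction on it happens outside the algorithm: `ι` needs no coding and `f` no
uniformity in `i`. -/
theorem Computable.list_const_flatMap (L : List ι) {f : ι → α → List β}
    (hf : ∀ i, Computable (f i)) : Computable fun a => L.flatMap fun i => f i a := by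
  induction L with
  | nil => exact Computable.const []
  | cons i L ih => exact (Computable.list_append.comp (hf i) ih).of_eq fun a => by simp

theorem Computable.list_const_all (L : List ι) {f : ι → α → Bool}
    (hf : ∀ i, Computable (f i)) : Computable fun a => L.all fun i => f i a := by
  induction L with
  | nil => exact Computable.const true
  | cons i L ih => exact (Primrec.and.to_comp.comp (hf i) ih).of_eq fun a => by simp

theorem Computable.list_getD {l : α → List β} {k : α → ℕ} (d : β) (hl : Computable l)
    (hk : Computable k) : Computable fun a => (l a).getD (k a) d :=
  (Primrec.list_getD d).to_comp.comp hl hk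

/-- If each `a` has a witness for one of two computable tests, then unbounded search computes which
of the tests has one. -/
theorem exists_computable_decision {check : α → σ → Bool} {check' : α → β → Bool}
    (h : Computable₂ check) (h' : Computable₂ check')
    (H : ∀ a, (∃ s, check a s = true) ∨ ∃ s, check' a s = true) :
    ∃ f : α → Bool, Computable f ∧ ∀ a,
      (f a = true → ∃ s, check a s = true) ∧ (f a = false → ∃ s, check' a s = true) := by
  -- One search over the codes of `σ ⊕ β` dovetails the two searches; the summand of the first hit
  -- is the answer.
  let F : α → σ ⊕ β → Option Bool := fun a t => Sum.casesOn t
    (fun s => bif check a s then some true else none)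
    (fun s => bif check' a s then some false else none)
  have hF : Computable₂ F := Computable.sumCasesOn Computable.snd
    (Computable.cond (h.comp (Computable.fst.comp Computable.fst) Computable.snd)
      (Computable.const (some true)) (Computable.const none)).to₂
    (Computable.cond (h'.comp (Computable.fst.comp Computable.fst) Computable.snd)
      (Computable.const (some false)) (Computable.const none)).to₂
  have hF₁ : ∀ a s, check a s = true → F a (Sum.inl s) = some true := fun a s hs => by simp [F, hs]
  have hF₂ : ∀ a s, check' a s = true → F a (Sum.inr s) = some false := fun a s hs => by
    simp [F, hs]
  have hG : Computable₂ fun (a : α) (k : ℕ) =>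
      (Encodable.decode k : Option (σ ⊕ β)).bind fun t => F a t :=
    (Computable.option_bind (Computable.decode.comp Computable.snd)
      (hF.comp (Computable.fst.comp Computable.fst) Computable.snd).to₂).to₂
  have hdom : ∀ a, (Nat.rfindOpt fun k =>
      (Encodable.decode k : Option (σ ⊕ β)).bind fun t => F a t).Dom := by
    intro a
    rw [Nat.rfindOpt_dom]
    rcases H a with ⟨s, hs⟩ | ⟨s, hs⟩
    · exact ⟨Encodable.encode (Sum.inl s : σ ⊕ β), true, by
        rw [Encodable.encodek]; exact hF₁ a s hs⟩
    · exact ⟨Encodable.encode (Sum.inr s : σ ⊕ β), false, by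
        rw [Encodable.encodek]; exact hF₂ a s hs⟩
  refine ⟨fun a => (Nat.rfindOpt _).get (hdom a),
    (Partrec.rfindOpt hG).of_eq_tot fun a => Part.get_mem (hdom a), fun a => ?_⟩
  obtain ⟨k, hk⟩ := Nat.rfindOpt_spec (Part.get_mem (hdom a))
  obtain ⟨t, -, ht⟩ := Option.bind_eq_some_iff.1 (Option.mem_def.1 hk)
  constructor
  · intro hf
    replace ht := ht.trans (congrArg some hf)
    rcases t with s | s
    · refine ⟨s, ?_⟩
      by_contra hc
      simp [F, Bool.eq_false_iff.2 hc] at ht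
    · cases hc : check' a s <;> simp [F, hc] at ht
  · intro hf
    replace ht := ht.trans (congrArg some hf)
    rcases t with s | s
    · cases hc : check a s <;> simp [F, hc] at ht
    · refine ⟨s, ?_⟩
      by_contra hc
      simp [F, Bool.eq_false_iff.2 hc] at ht

/-- Integers are coded with `k ≥ 0` as `2 * k` and `-(k + 1)` as `2 * k + 1`, so parity is the sign.
With positive and negative parts available, equations between degrees can be tested in `ℕ`. -/
theorem Primrec.int_toNat : Primrec Int.toNat := by
  refine (Primrec.cond (Primrec.nat_bodd.comp Primrec.encode) (Primrec.const 0)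
    (Primrec.nat_div2.comp Primrec.encode) : Primrec fun z : ℤ =>
      bif (Encodable.encode z).bodd then 0 else (Encodable.encode z).div2).of_eq fun z => ?_
  cases z with
  | ofNat k =>
    have : Encodable.encode (Int.ofNat k) = 2 * k := rfl
    rw [this]; simp [Nat.div2_val]
  | negSucc k =>
    have : Encodable.encode (Int.negSucc k) = 2 * k + 1 := rfl
    rw [this]; simp

theorem Primrec.int_neg_toNat : Primrec fun z : ℤ => (-z).toNat := by
  refine (Primrec.cond (Primrec.nat_bodd.comp Primrec.encode)
    (Primrec.succ.comp (Primrec.nat_div2.comp Primrec.encode)) (Primrec.const 0):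
      Primrec fun z : ℤ =>
      bif (Encodable.encode z).bodd then (Encodable.encode z).div2.succ else 0).of_eq fun z => ?_
  cases z with
  | ofNat k =>
    have : Encodable.encode (Int.ofNat k) = 2 * k := rfl
    rw [this]; simp
  | negSucc k =>
    have : Encodable.encode (Int.negSucc k) = 2 * k + 1 := rfl
    rw [this]; simp [Nat.div2_val]

end Computability

/-! ### Ideal membership and nonzerodivisors modulo an ideal, by linear systems over `B`. -/

section Solver

variable {B : Type*} [CommRing B]

theorem mem_idealOfList_iff {P : List B} {b : B} :
    b ∈ idealOfList P ↔ ∃ y : Fin P.length → B, ∑ k, y k * P.get k = b := by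
  have : idealOfList P = Ideal.span (Set.range P.get) := by
    rw [idealOfList, Set.range_list_get]
  rw [this, Ideal.mem_span_range_iff_exists_fun]

theorem matrixOfRows_apply (p q : ℕ) (rows : List (List B)) (i : Fin p) (j : Fin q) :
    matrixOfRows p q rows i j = (rows.getD i []).getD j 0 := rfl

theorem getD_map_singleton (P : List B) (k : ℕ) :
    ((P.map fun b => [b]).getD k []).getD 0 0 = P.getD k 0 := by
  rcases lt_or_ge k P.length with h | h <;> simp [h]

/-- The system expressing the elements of `L` by the elements of `P`. -/
abbrev membershipSystem (P L : List B) : LinearSystem B :=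
  ((P.length, 1, L.length), P.map fun b => [b], L.map fun b => [b])

theorem membershipSystem_solutions_nonempty {P L : List B} :
    (membershipSystem P L).solutions.Nonempty ↔ ∀ b ∈ L, b ∈ idealOfList P := by
  have key : ∀ X : Matrix (Fin L.length) (Fin P.length) B,
      X ∈ (membershipSystem P L).solutions ↔ ∀ i, ∑ k, X i k * P.get k = L.get i := by
    intro X
    change X * matrixOfRows P.length 1 (P.map fun b => [b]) =
      matrixOfRows L.length 1 (L.map fun b => [b]) ↔ _
    rw [← Matrix.ext_iff]
    refine forall_congr' fun i => ?_
    rw [Fin.forall_fin_one, Matrix.mul_apply, matrixOfRows_apply]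
    simp only [matrixOfRows_apply, Fin.val_zero, getD_map_singleton]
    simp
  constructor
  · rintro ⟨X, hX⟩ b hb
    obtain ⟨i, rfl⟩ := List.get_of_mem hb
    exact mem_idealOfList_iff.2 ⟨X i, (key X).1 hX i⟩
  · intro h
    choose y hy using fun i => mem_idealOfList_iff.1 (h (L.get i) (L.get_mem i))
    exact ⟨Matrix.of y, (key _).2 hy⟩

/-- The homogeneous system of the relations between the entries of `s :: P`. -/
abbrev relationSystem (P : List B) (s : B) : LinearSystem B :=
  ((P.length + 1, 1, 1), (s :: P).map fun b => [b], [])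

theorem mem_relationSystem_solutions {P : List B} {s : B}
    {X : Matrix (Fin 1) (Fin (P.length + 1)) B} :
    X ∈ (relationSystem P s).solutions ↔
      X 0 0 * s + ∑ k : Fin P.length, X 0 k.succ * P.get k = 0 := by
  change X * matrixOfRows (P.length + 1) 1 ((s :: P).map fun b => [b]) = matrixOfRows 1 1 [] ↔ _
  rw [← Matrix.ext_iff, Fin.forall_fin_one, Fin.forall_fin_one, Matrix.mul_apply,
    Fin.sum_univ_succ]
  simp only [matrixOfRows_apply, Fin.val_zero, getD_map_singleton, Fin.val_succ]
  simp

/-- The colon ideal of `P` by `s` consists of the first coordinates of the syzygies of `s :: P`, and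
these the solver computes. -/
theorem exists_relation_iff {P : List B} {s b : B} :
    (∃ X : Matrix (Fin 1) (Fin (P.length + 1)) B,
      X ∈ (relationSystem P s).solutions ∧ X 0 0 = b) ↔ s * b ∈ idealOfList P := by
  constructor
  · rintro ⟨X, hX, rfl⟩
    rw [mem_relationSystem_solutions] at hX
    refine mem_idealOfList_iff.2 ⟨fun k => - X 0 k.succ, ?_⟩
    simp only [neg_mul, Finset.sum_neg_distrib]
    linear_combination -hX
  · intro h
    obtain ⟨y, hy⟩ := mem_idealOfList_iff.1 h
    refine ⟨Matrix.of fun _ => Fin.cons b fun k => - y k, mem_relationSystem_solutions.2 ?_, rfl⟩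
    simp only [Matrix.of_apply, Fin.cons_zero, Fin.cons_succ, neg_mul, Finset.sum_neg_distrib, hy]
    ring

variable [Primcodable B]

theorem IsComputableRing.exists_membership_test (hB : IsComputableRing B) :
    ∃ t : List B → List B → Bool, Computable₂ t ∧
      ∀ P L, t P L = true ↔ ∀ b ∈ L, b ∈ idealOfList P := by
  obtain ⟨solve, hs, hspec⟩ := hB.solve
  have hsing : Primrec₂ fun (_ : List B) (b : B) => [b] :=
    Primrec.list_cons.comp Primrec.snd (Primrec.const [])
  have hm : Primrec fun P : List B => P.map fun b => [b] := Primrec.list_map Primrec.id hsing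
  refine ⟨fun P L => (solve (membershipSystem P L)).isSome, ?_, fun P L => ?_⟩
  · refine Primrec.option_isSome.to_comp.comp (hs.comp (Primrec.to_comp ?_))
    exact ((Primrec.list_length.comp Primrec.fst).pair
      ((Primrec.const 1).pair (Primrec.list_length.comp Primrec.snd))).pair
      ((hm.comp Primrec.fst).pair (hm.comp Primrec.snd))
  · change (solve (membershipSystem P L)).isSome = true ↔ _
    rw [← membershipSystem_solutions_nonempty]
    obtain ⟨h1, h2⟩ := hspec (membershipSystem P L)
    cases h : solve (membershipSystem P L) with
    | none => simp [h1 h]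
    | some a =>
      simp only [Option.isSome_some, true_iff, h2 a h]
      exact ⟨matrixOfRows L.length P.length a.1, by simp [affineSpaceOf]⟩

theorem IsComputableRing.exists_nonZeroDivisor_test (hB : IsComputableRing B) :
    ∃ t : List B → B → Bool, Computable₂ t ∧
      ∀ P s, t P s = true ↔ ∀ b, s * b ∈ idealOfList P → b ∈ idealOfList P := by
  obtain ⟨mem, hmem, mem_iff⟩ := hB.exists_membership_test
  obtain ⟨solve, hs, hspec⟩ := hB.solve
  have hsing : Primrec₂ fun (_ : List B) (b : B) => [b] :=
    Primrec.list_cons.comp Primrec.snd (Primrec.const [])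
  have hm : Primrec fun P : List B => P.map fun b => [b] := Primrec.list_map Primrec.id hsing
  let entry : List (List B) → B := fun rows => (rows.getD 0 []).getD 0 0
  have hentry : Primrec entry :=
    (Primrec.list_getD 0).comp ((Primrec.list_getD []).comp Primrec.id (Primrec.const 0))
      (Primrec.const 0)
  have hsys : Primrec₂ fun (P : List B) (s : B) => relationSystem P s :=
    ((Primrec.succ.comp (Primrec.list_length.comp Primrec.fst)).pair
      (Primrec.const (1, 1))).pair
      ((hm.comp (Primrec.list_cons.comp Primrec.snd Primrec.fst)).pair (Primrec.const []))
  -- The value `false` is never reached, since the homogeneous system has the solution zero.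
  -- Otherwise it is tested that the first entries of the affine generators lie in the ideal.
  refine ⟨fun P s => Option.casesOn (solve (relationSystem P s)) false
    fun a => mem P (entry a.1 :: a.2.map entry), ?_, fun P s => ?_⟩
  · refine Computable.option_casesOn (hs.comp hsys.to_comp) (Computable.const false) ?_
    refine hmem.comp (Computable.fst.comp Computable.fst) (Primrec.to_comp ?_)
    refine Primrec.list_cons.comp (hentry.comp (Primrec.fst.comp Primrec.snd)) ?_
    exact Primrec.list_map (Primrec.snd.comp Primrec.snd) (hentry.comp Primrec.snd).to₂
  · change (Option.casesOn (solve (relationSystem P s)) false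
      fun a => mem P (entry a.1 :: a.2.map entry) : Bool) = true ↔ _
    obtain ⟨h1, h2⟩ := hspec (relationSystem P s)
    cases h : solve (relationSystem P s) with
    | none =>
      obtain ⟨X, hX, -⟩ := (exists_relation_iff (P := P) (s := s) (b := 0)).2 (by simp)
      rw [h1 h] at hX
      exact hX.elim
    | some a =>
      have hsol := h2 a h
      change mem P (entry a.1 :: a.2.map entry) = true ↔ _
      have hent : ∀ rows, matrixOfRows 1 (P.length + 1) rows 0 0 = entry rows := fun _ => rfl
      rw [mem_iff]
      simp only [← exists_relation_iff, hsol, List.forall_mem_cons, List.forall_mem_map]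
      constructor
      · rintro ⟨hX0, hH⟩ b ⟨X, hX, rfl⟩
        rw [affineSpaceOf, Set.mem_ofPred_eq] at hX
        have : ∀ Y ∈ Submodule.span B
            {H | ∃ rows ∈ a.2, H = matrixOfRows 1 (P.length + 1) rows},
            Y 0 0 ∈ idealOfList P := by
          intro Y hY
          induction hY using Submodule.span_induction with
          | mem Y hY =>
            obtain ⟨rows, hr, rfl⟩ := hY
            exact hH rows hr
          | zero => exact Ideal.zero_mem _
          | add Y Z _ _ hY hZ => exact Ideal.add_mem _ hY hZ
          | smul c Y _ hY => exact Ideal.mul_mem_left _ c hY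
        have := Ideal.add_mem _ (this _ hX) hX0
        rwa [← hent, Matrix.sub_apply, sub_add_cancel] at this
      -- The particular solution and its sums with each direction are solutions; subtraction handles
      -- the directions themselves.
      · intro H
        have hX0 : entry a.1 ∈ idealOfList P :=
          H _ ⟨matrixOfRows 1 (P.length + 1) a.1, by simp [affineSpaceOf], rfl⟩
        refine ⟨hX0, fun rows hr => ?_⟩
        have := H _ ⟨matrixOfRows 1 (P.length + 1) a.1 + matrixOfRows 1 (P.length + 1) rows,
          ?_, rfl⟩
        · rw [Matrix.add_apply, hent, hent] at this
          exact (Ideal.add_mem_iff_right _ hX0).1 this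
        · rw [affineSpaceOf, Set.mem_ofPred_eq, add_sub_cancel_left]
          exact Submodule.subset_span ⟨rows, hr, rfl⟩

end Solver

/-! ### Coded polynomials: arithmetic and coefficients. -/

namespace PolyCode

section Semantics

variable {B : Type*} [CommRing B] {n : ℕ}

/-- The coefficient at the monomial with exponents `e`. -/
def coeffAt (l : PolyCode B n) (e : Fin (n + 1) → ℕ) : B :=
  (l.map fun t => if t.2 = e then t.1 else 0).sum

/-- The product of two polynomials given by terms. -/
protected def mul (l l' : PolyCode B n) : PolyCode B n :=
  l.flatMap fun t => l'.map fun t' => (t.1 * t'.1, t.2 + t'.2)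

theorem toPoly_nil : toPoly ([] : PolyCode B n) = 0 := rfl

theorem toPoly_cons (t : B × (Fin (n + 1) → ℕ)) (l : PolyCode B n) :
    toPoly (t :: l) =
      MvPolynomial.monomial (Finsupp.equivFunOnFinite.symm t.2) t.1 + toPoly l := by
  simp [toPoly]

theorem toPoly_append (l l' : PolyCode B n) : toPoly (l ++ l') = toPoly l + toPoly l' := by
  simp [toPoly]

theorem toPoly_flatMap {ι : Type*} (L : List ι) (f : ι → PolyCode B n) :
    toPoly (L.flatMap f) = (L.map fun i => toPoly (f i)).sum := by
  induction L with
  | nil => rfl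
  | cons i L ih => simp [toPoly_append, ih]

theorem toPoly_mul (l l' : PolyCode B n) : toPoly (l.mul l') = toPoly l * toPoly l' := by
  rw [PolyCode.mul, toPoly_flatMap]
  induction l with
  | nil => simp [toPoly_nil]
  | cons t l ih =>
    rw [List.map_cons, List.sum_cons, ih, toPoly_cons, add_mul]
    congr 1
    clear ih
    induction l' with
    | nil => simp [toPoly_nil]
    | cons t' l' ih =>
      rw [List.map_cons, toPoly_cons, ih, toPoly_cons, mul_add, MvPolynomial.monomial_mul]
      congr 3
      ext
      rfl

theorem coeff_toPoly (l : PolyCode B n) (e : Fin (n + 1) → ℕ) :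
    (toPoly l).coeff (Finsupp.equivFunOnFinite.symm e) = l.coeffAt e := by
  induction l with
  | nil => rfl
  | cons t l ih =>
    rw [toPoly_cons, MvPolynomial.coeff_add, ih, MvPolynomial.coeff_monomial]
    simp [coeffAt]

/-- The code may be chosen without superfluous terms, so that exponent bounds for the polynomial
hold for every listed term. -/
theorem exists_toPoly_eq (f : MvPolynomial (Fin (n + 1)) B) : ∃ l : PolyCode B n,
    toPoly l = f ∧ ∀ t ∈ l, f.coeff (Finsupp.equivFunOnFinite.symm t.2) ≠ 0 := by
  refine ⟨f.support.toList.map fun e => (f.coeff e, e), ?_, ?_⟩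
  · conv_rhs => rw [f.as_sum]
    rw [toPoly, List.map_map, ← Finset.sum_map_toList]
    congr 1
    refine List.map_congr_left fun e _ => ?_
    have : Finsupp.equivFunOnFinite.symm (e : Fin (n + 1) → ℕ) = e := by ext; rfl
    simp [this]
  · intro t ht
    obtain ⟨e, he, rfl⟩ := List.mem_map.1 ht
    have : Finsupp.equivFunOnFinite.symm (e : Fin (n + 1) → ℕ) = e := by ext; rfl
    rw [this]
    exact MvPolynomial.mem_support_iff.1 (Finset.mem_toList.1 he)

theorem exists_mem_of_coeff_ne_zero {l : PolyCode B n} {e : Fin (n + 1) →₀ ℕ}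
    (h : (toPoly l).coeff e ≠ 0) : ∃ t ∈ l, t.2 = e := by
  by_contra! H
  refine h ?_
  have : e = Finsupp.equivFunOnFinite.symm (e : Fin (n + 1) → ℕ) := by ext; rfl
  rw [this, coeff_toPoly, coeffAt]
  refine List.sum_eq_zero fun b hb => ?_
  obtain ⟨t, ht, rfl⟩ := List.mem_map.1 hb
  exact if_neg (H t ht)

/-- Coefficients at unlisted exponents vanish, so finitely many checks suffice. Repeated exponents
do no harm because `coeffAt` adds them up. -/
theorem forall_coeffAt_mem_iff (I : Ideal B) (l : PolyCode B n) :
    (∀ t ∈ l, l.coeffAt t.2 ∈ I) ↔ toPoly l ∈ I.map MvPolynomial.C := by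
  rw [MvPolynomial.mem_map_C_iff]
  constructor
  · intro H e
    by_cases h : (toPoly l).coeff e = 0
    · rw [h]; exact I.zero_mem
    · obtain ⟨t, ht, hte⟩ := exists_mem_of_coeff_ne_zero h
      have : e = Finsupp.equivFunOnFinite.symm t.2 := by ext; rw [hte]; rfl
      rw [this, coeff_toPoly]
      exact H t ht
  · intro H t _
    rw [← coeff_toPoly]
    exact H _

end Semantics

end PolyCode

/-! ### Division by monic polynomials in the single variables. -/

namespace MvPolynomial

section Remainder

variable {σ B : Type*} [CommRing B]

/-- The `B`-linear map which replaces each power of `X i` by its remainder modulo `g (X i)`. -/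
noncomputable def remainderX (i : σ) (g : Polynomial B) : MvPolynomial σ B →ₗ[B] MvPolynomial σ B :=
  (basisMonomials σ B).constr B fun e =>
    monomial (e.erase i) 1 * Polynomial.aeval (X i) ((Polynomial.X ^ e i : Polynomial B) %ₘ g)

theorem remainderX_monomial (i : σ) (g : Polynomial B) (e : σ →₀ ℕ) :
    remainderX i g (monomial e 1) =
      monomial (e.erase i) 1 *
        Polynomial.aeval (X i) ((Polynomial.X ^ e i : Polynomial B) %ₘ g) := by
  have := (basisMonomials σ B).constr_basis B (fun e =>
    monomial (e.erase i) (1 : B) *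
      Polynomial.aeval (X i) ((Polynomial.X ^ e i : Polynomial B) %ₘ g)) e
  rwa [coe_basisMonomials] at this

theorem monomial_mul_aeval_X (i : σ) (e : σ →₀ ℕ) (q : Polynomial B) :
    monomial e 1 * Polynomial.aeval (X i) q =
      q.sum fun k b => monomial (e + Finsupp.single i k) b := by
  rw [Polynomial.aeval_eq_sum_range, Polynomial.sum_over_range _ (by simp), Finset.mul_sum]
  refine Finset.sum_congr rfl fun k _ => ?_
  rw [X_pow_eq_monomial, smul_monomial, monomial_mul, one_mul, smul_eq_mul, mul_one]

theorem monomial_erase_mul_X_pow (i : σ) (e : σ →₀ ℕ) :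
    (monomial (e.erase i) 1 * X i ^ e i : MvPolynomial σ B) = monomial e 1 := by
  rw [X_pow_eq_monomial, monomial_mul, Finsupp.erase_add_single, one_mul]

/-- By `he` the monomial involves only the other variables, and taking remainders in `X i` is linear
over these. This allows remainders of products to be computed in one variable. -/
theorem remainderX_monomial_mul (i : σ) {g : Polynomial B} (e : σ →₀ ℕ) (he : e i = 0)
    (q : Polynomial B) :
    remainderX i g (monomial e 1 * Polynomial.aeval (X i) q) =
      monomial e 1 * Polynomial.aeval (X i) (q %ₘ g) := by
  induction q using Polynomial.induction_on' with
  | add p q hp hq => rw [map_add, mul_add, map_add, hp, hq, Polynomial.add_modByMonic, map_add, mul_add]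
  | monomial k b =>
    rw [← mul_one b, ← smul_eq_mul (a := b), ← Polynomial.smul_monomial, map_smul, mul_smul_comm, map_smul,
      Polynomial.smul_modByMonic, map_smul, mul_smul_comm, Polynomial.monomial_one_right_eq_X_pow,
      map_pow, Polynomial.aeval_X, X_pow_eq_monomial, monomial_mul, one_mul, remainderX_monomial]
    congr 3
    · rw [Finsupp.erase_add, Finsupp.erase_single, add_zero,
        Finsupp.erase_of_notMem_support (by simpa using he)]
    · simp [he]

theorem induction_on_monomial_smul {p : MvPolynomial σ B → Prop} (f : MvPolynomial σ B)
    (mono : ∀ e, p (monomial e 1)) (add : ∀ f g, p f → p g → p (f + g))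
    (smul : ∀ (b : B) f, p f → p (b • f)) : p f := by
  induction f using MvPolynomial.monomial_add_induction_on with
  | C a =>
    have := smul a _ (mono 0)
    rwa [smul_monomial, smul_eq_mul, mul_one] at this
  | monomial_add e a f _ _ hf =>
    have := smul a _ (mono e)
    rw [smul_monomial, smul_eq_mul, mul_one] at this
    exact add _ _ this hf

theorem remainderX_aeval_mul (i : σ) {g : Polynomial B} (hg : g.Monic) (h : MvPolynomial σ B) :
    remainderX i g (Polynomial.aeval (X i) g * h) = 0 := by
  induction h using induction_on_monomial_smul with
  | mono e =>
    rw [← monomial_erase_mul_X_pow i e, mul_left_comm, ← Polynomial.aeval_X_pow (R := B) (X i),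
      ← map_mul, remainderX_monomial_mul i _ (by simp), Polynomial.self_mul_modByMonic hg, map_zero,
      mul_zero]
  | add f f' hf hf' => rw [mul_add, map_add, hf, hf', add_zero]
  | smul b f hf => rw [mul_smul_comm, map_smul, hf, smul_zero]

theorem remainderX_X_mul {i j : σ} (hij : j ≠ i) (g : Polynomial B) (h : MvPolynomial σ B) :
    remainderX i g (X j * h) = X j * remainderX i g h := by
  induction h using induction_on_monomial_smul with
  | mono e =>
    rw [X, monomial_mul, one_mul, remainderX_monomial, remainderX_monomial, ← mul_assoc,
      monomial_mul, one_mul, Finsupp.erase_add, Finsupp.erase_single_ne hij.symm]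
    simp [hij]
  | add f f' hf hf' => rw [mul_add, map_add, hf, hf', map_add, mul_add]
  | smul b f hf => rw [mul_smul_comm, map_smul, hf, map_smul, mul_smul_comm]

theorem remainderX_aeval_mul_of_ne {i j : σ} (hij : j ≠ i) (g q : Polynomial B)
    (h : MvPolynomial σ B) :
    remainderX i g (Polynomial.aeval (X j) q * h) =
      Polynomial.aeval (X j) q * remainderX i g h := by
  induction q using Polynomial.induction_on' with
  | add p q hp hq => rw [map_add, add_mul, map_add, hp, hq, add_mul]
  | monomial k b =>
    rw [Polynomial.aeval_monomial, mul_assoc, mul_assoc, ← Algebra.smul_def, ← Algebra.smul_def,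
      map_smul]
    congr 1
    induction k with
    | zero => simp
    | succ k ih => rw [pow_succ', mul_assoc, remainderX_X_mul hij, ih, mul_assoc]

/-- The polynomials all of whose monomials have degree less than `d` in `X i`. -/
def reducedIn (B : Type*) [CommRing B] (i : σ) (d : ℕ) : Submodule B (MvPolynomial σ B) where
  carrier := {f | ∀ e : σ →₀ ℕ, d ≤ e i → coeff e f = 0}
  zero_mem' _ _ := coeff_zero _
  add_mem' hf hg e he := by rw [coeff_add, hf e he, hg e he, add_zero]
  smul_mem' b f hf e he := by rw [coeff_smul, hf e he, smul_zero]

theorem monomial_mem_reducedIn {i : σ} {d : ℕ} {e : σ →₀ ℕ} (b : B) (h : e i < d) :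
    monomial e b ∈ reducedIn B i d := by
  classical
  intro e' he'
  rw [coeff_monomial, if_neg]
  rintro rfl
  omega

theorem map_mem_of_monomial {f : MvPolynomial σ B} (N : Submodule B (MvPolynomial σ B))
    (φ : MvPolynomial σ B →ₗ[B] MvPolynomial σ B)
    (h : ∀ e, coeff e f ≠ 0 → φ (monomial e 1) ∈ N) : φ f ∈ N := by
  rw [f.as_sum, map_sum]
  refine N.sum_mem fun e he => ?_
  rw [← mul_one (coeff e f), ← smul_eq_mul, ← smul_monomial, map_smul]
  exact N.smul_mem _ (h e (mem_support_iff.1 he))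

theorem remainderX_of_mem_reducedIn {i : σ} {g : Polynomial B} (hg : g.Monic)
    {f : MvPolynomial σ B} (hf : f ∈ reducedIn B i g.natDegree) : remainderX i g f = f := by
  refine sub_eq_zero.1 ((Submodule.mem_bot B).1
    (map_mem_of_monomial ⊥ (remainderX i g - LinearMap.id) fun e he => ?_))
  have hlt : e i < g.natDegree := by
    by_contra hc
    exact he (hf e (not_lt.1 hc))
  nontriviality B
  rw [Submodule.mem_bot, LinearMap.sub_apply, remainderX_monomial,
    (Polynomial.modByMonic_eq_self_iff hg).2, map_pow, Polynomial.aeval_X,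
    monomial_erase_mul_X_pow, LinearMap.id_apply, sub_self]
  rw [Polynomial.degree_X_pow, Polynomial.degree_eq_natDegree hg.ne_zero]
  exact_mod_cast hlt

theorem remainderX_mem_reducedIn_self (i : σ) {g : Polynomial B} (hg : g.Monic)
    (f : MvPolynomial σ B) : remainderX i g f ∈ reducedIn B i g.natDegree := by
  rcases subsingleton_or_nontrivial B with _ | _
  · exact fun _ _ => Subsingleton.elim _ _
  refine map_mem_of_monomial _ _ fun e _ => ?_
  rw [remainderX_monomial, monomial_mul_aeval_X]
  refine Submodule.sum_mem _ fun k hk => monomial_mem_reducedIn _ ?_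
  have h1 := Polynomial.le_degree_of_mem_supp k hk
  have h2 := Polynomial.degree_modByMonic_lt ((Polynomial.X : Polynomial B) ^ e i) hg
  rw [Polynomial.degree_eq_natDegree hg.ne_zero] at h2
  have : k < g.natDegree := by exact_mod_cast h1.trans_lt h2
  simpa using this

theorem remainderX_mem_reducedIn {i j : σ} (hij : j ≠ i) (g : Polynomial B) {d : ℕ}
    {f : MvPolynomial σ B} (hf : f ∈ reducedIn B j d) : remainderX i g f ∈ reducedIn B j d := by
  refine map_mem_of_monomial _ _ fun e he => ?_
  rw [remainderX_monomial, monomial_mul_aeval_X]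
  refine Submodule.sum_mem _ fun k hk => monomial_mem_reducedIn _ ?_
  have hlt : e j < d := by
    by_contra hc
    exact he (hf e (not_lt.1 hc))
  simpa [hij, Finsupp.single_apply, hij.symm] using hlt

theorem exists_remainderX_sub_eq (i : σ) (g : Polynomial B) (f : MvPolynomial σ B) :
    ∃ h, remainderX i g f - f = Polynomial.aeval (X i) g * h := by
  induction f using induction_on_monomial_smul with
  | mono e =>
    refine ⟨- (monomial (e.erase i) 1 *
      Polynomial.aeval (X i) ((Polynomial.X ^ e i : Polynomial B) /ₘ g)), ?_⟩
    conv_lhs => enter [2]; rw [← monomial_erase_mul_X_pow i e]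
    have h := congrArg (Polynomial.aeval (X i : MvPolynomial σ B))
      (Polynomial.modByMonic_add_div (Polynomial.X ^ e i : Polynomial B) g)
    rw [map_add, map_mul, map_pow, Polynomial.aeval_X] at h
    rw [remainderX_monomial, ← h]
    ring
  | add f f' hf hf' =>
    obtain ⟨h, hh⟩ := hf
    obtain ⟨h', hh'⟩ := hf'
    exact ⟨h + h', by rw [map_add, mul_add, ← hh, ← hh']; ring⟩
  | smul b f hf =>
    obtain ⟨h, hh⟩ := hf
    exact ⟨b • h, by rw [map_smul, mul_smul_comm, ← hh, smul_sub]⟩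

theorem remainderX_mem_map_C (i : σ) (g : Polynomial B) {I : Ideal B} {f : MvPolynomial σ B}
    (hf : f ∈ I.map C) : remainderX i g f ∈ I.map C := by
  rw [f.as_sum, map_sum]
  refine Ideal.sum_mem _ fun e _ => ?_
  rw [← mul_one (coeff e f), ← smul_eq_mul, ← smul_monomial, map_smul, smul_eq_C_mul]
  exact Ideal.mul_mem_right _ _ (Ideal.mem_map_of_mem _ (mem_map_C_iff.1 hf e))

/-- Every polynomial is congruent to a reduced one modulo monic polynomials `g i (X i)`. -/
theorem exists_reduced (g : σ → Polynomial B) (hg : ∀ i, (g i).Monic) (T : Finset σ)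
    (f : MvPolynomial σ B) :
    ∃ h : σ → MvPolynomial σ B,
      ∀ i ∈ T, f + ∑ j ∈ T, Polynomial.aeval (X j) (g j) * h j ∈ reducedIn B i (g i).natDegree := by
  classical
  induction T using Finset.induction_on with
  | empty => exact ⟨0, by simp⟩
  | insert i T hi ih =>
    obtain ⟨h, hh⟩ := ih
    obtain ⟨q, hq⟩ := exists_remainderX_sub_eq i (g i)
      (f + ∑ j ∈ T, Polynomial.aeval (X j) (g j) * h j)
    have key : f + ∑ j ∈ insert i T, Polynomial.aeval (X j) (g j) * Function.update h i q j =
        remainderX i (g i) (f + ∑ j ∈ T, Polynomial.aeval (X j) (g j) * h j) := by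
      rw [Finset.sum_insert hi, Function.update_self, ← hq]
      have : ∑ j ∈ T, Polynomial.aeval (X j) (g j) * Function.update h i q j =
          ∑ j ∈ T, Polynomial.aeval (X j) (g j) * h j :=
        Finset.sum_congr rfl fun j hj => by
          rw [Function.update_of_ne (ne_of_mem_of_not_mem hj hi)]
      rw [this]
      ring
    -- Division in `X i` does not raise degrees in the other variables, so what was already reduced
    -- stays reduced.
    refine ⟨Function.update h i q, fun j hj => ?_⟩
    rw [key]
    by_cases hji : j = i
    · subst hji
      exact remainderX_mem_reducedIn_self _ (hg j) _
    · exact remainderX_mem_reducedIn hji _ (hh j (Finset.mem_of_mem_insert_of_ne hj hji))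

/-- A reduced polynomial in the ideal generated by `I` and monic polynomials `g i (X i)` has
coefficients in `I`. -/
theorem mem_map_C_of_reduced (g : σ → Polynomial B) (hg : ∀ i, (g i).Monic) (I : Ideal B)
    (T : Finset σ) {f : MvPolynomial σ B} (hf : ∀ i ∈ T, f ∈ reducedIn B i (g i).natDegree)
    (h : σ → MvPolynomial σ B)
    (hI : f + ∑ j ∈ T, Polynomial.aeval (X j) (g j) * h j ∈ I.map C) : f ∈ I.map C := by
  classical
  induction T using Finset.induction_on generalizing h with
  | empty => simpa using hI
  | insert i T hi ih =>
    -- `remainderX i (g i)` preserves `I.map C`, fixes the reduced `f`, kills the `i`-th summand and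
    -- acts on the other summands only through their cofactors `h j`. This removes `i` from the sum.
    refine ih (fun j hj => hf j (Finset.mem_insert_of_mem hj))
      (fun j => remainderX i (g i) (h j)) ?_
    have := remainderX_mem_map_C i (g i) hI
    rw [Finset.sum_insert hi, map_add, map_add, remainderX_aeval_mul i (hg i), zero_add,
      remainderX_of_mem_reducedIn (hg i) (hf i (Finset.mem_insert_self i T)), map_sum] at this
    convert this using 2
    exact Finset.sum_congr rfl fun j hj => by
      rw [remainderX_aeval_mul_of_ne (ne_of_mem_of_not_mem hj hi)]

end Remainder

end MvPolynomial

/-! ### Scaling of coordinates, Zariski's lemma, associated primes and simple quotients. -/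

namespace MvPolynomial

section Scaling

variable {σ B : Type*} [CommRing B]

/-- The substitution `X i ↦ s * X i`. -/
noncomputable def scaleX (σ : Type*) (s : B) : MvPolynomial σ B →ₐ[B] MvPolynomial σ B :=
  aeval fun i => C s * X i

theorem scaleX_monomial (s : B) (e : σ →₀ ℕ) (b : B) :
    scaleX σ s (monomial e b) = monomial e (s ^ e.degree * b) := by
  rw [scaleX, aeval_monomial, Finsupp.prod]
  simp only [mul_pow]
  rw [Finset.prod_mul_distrib, Finset.prod_pow_eq_pow_sum, ← Finsupp.degree_apply, monomial_eq,
    Finsupp.prod, algebraMap_eq, C_mul, C_pow]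
  ring

theorem scaleX_of_isHomogeneous (s : B) {f : MvPolynomial σ B} {k : ℕ} (hf : f.IsHomogeneous k) :
    scaleX σ s f = C s ^ k * f := by
  conv_lhs => rw [f.as_sum]
  conv_rhs => rw [f.as_sum]
  rw [map_sum, Finset.mul_sum]
  refine Finset.sum_congr rfl fun e he => ?_
  rw [scaleX_monomial, ← C_pow, C_mul_monomial]
  have := hf (mem_support_iff.1 he)
  rw [show e.degree = k by rw [← this, Finsupp.degree_eq_weight_one]; rfl]

/-- Scaling multiplies a monomial of degree `d` by `s ^ d`; putting the missing factor `s ^ (k - d)`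
into the coefficient makes the total factor `s ^ k` uniform. -/
theorem exists_scaleX_eq (s : B) (f : MvPolynomial σ B) {k : ℕ} (hk : f.totalDegree ≤ k) :
    ∃ f', scaleX σ s f' = C s ^ k * f := by
  refine ⟨∑ e ∈ f.support, monomial e (s ^ (k - e.degree) * coeff e f), ?_⟩
  conv_rhs => rw [f.as_sum]
  rw [map_sum, Finset.mul_sum]
  refine Finset.sum_congr rfl fun e he => ?_
  rw [scaleX_monomial, ← C_pow, C_mul_monomial, ← mul_assoc, ← pow_add]
  have : e.degree ≤ k := (le_totalDegree he).trans hk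
  rw [Nat.add_sub_cancel' this]

theorem scaleX_aeval_X (s : B) (i : σ) (g : Polynomial B) :
    scaleX σ s (Polynomial.aeval (X i) g) = Polynomial.aeval (C s * X i : MvPolynomial σ B) g := by
  rw [← Polynomial.aeval_algHom_apply, scaleX, aeval_X]

end Scaling

section Certificate

variable {σ B : Type*} [CommRing B]

/-- Zariski's lemma: the residue field is integral after scaling the coordinates. -/
theorem exists_scaled_integral [Finite σ] (𝔫 : Ideal (MvPolynomial σ B)) [h𝔫 : 𝔫.IsMaximal] :
    ∃ s : B, C s ∉ 𝔫 ∧ ∀ i, ∃ g : Polynomial B, g.Monic ∧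
      Polynomial.aeval (C s * X i : MvPolynomial σ B) g ∈ 𝔫 := by
  classical
  cases nonempty_fintype σ
  let κ := MvPolynomial σ B ⧸ 𝔫
  let _ : Field κ := Ideal.Quotient.field 𝔫
  let A := B ⧸ 𝔫.comap (algebraMap B (MvPolynomial σ B))
  have : (𝔫.comap (algebraMap B (MvPolynomial σ B))).IsPrime := Ideal.comap_isPrime _ _
  have hinj : Function.Injective (algebraMap A κ) := Ideal.algebraMap_quotient_injective
  have : FaithfulSMul A κ := (faithfulSMul_iff_algebraMap_injective A κ).2 hinj
  let K := FractionRing A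
  let _ : Algebra K κ := FractionRing.liftAlgebra A κ
  have : IsScalarTower A K κ := FractionRing.isScalarTower_liftAlgebra A κ
  have : Algebra.FiniteType B κ := inferInstance
  have : Algebra.FiniteType A κ := Algebra.FiniteType.of_restrictScalars_finiteType B A κ
  have : Algebra.FiniteType K κ := Algebra.FiniteType.of_restrictScalars_finiteType A K κ
  -- Zariski's lemma: a field of finite type over the fraction field `K` of `A` is finite over it.
  -- The finitely many coordinates are then algebraic, and one denominator `y` from `A` makes them
  -- all integral.
  have : Module.Finite K κ := finite_of_finite_type_of_isJacobsonRing K κ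
  obtain ⟨y, hy, hint⟩ := exists_integral_multiples A K
    (Finset.univ.image fun i => Ideal.Quotient.mk 𝔫 (X i))
  obtain ⟨s, rfl⟩ := Ideal.Quotient.mk_surjective y
  refine ⟨s, fun hs => hy (Ideal.Quotient.eq_zero_iff_mem.2 hs), fun i => ?_⟩
  have h1 := hint _ (Finset.mem_image_of_mem _ (Finset.mem_univ i))
  have : Algebra.IsIntegral B A := Algebra.isIntegral_of_surjective Ideal.Quotient.mk_surjective
  have h2 : IsIntegral B (Ideal.Quotient.mk 𝔫 (C s * X i)) := by
    have := isIntegral_trans (R := B) _ h1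
    rwa [Algebra.smul_def] at this
  obtain ⟨g, hg, hg0⟩ := h2
  refine ⟨g, hg, Ideal.Quotient.eq_zero_iff_mem.1 ?_⟩
  rw [← hg0, Polynomial.aeval_def, Polynomial.hom_eval₂]
  rfl

/-- The ideal generated by `I` and the polynomials `g i (X i)`. -/
noncomputable def boxIdeal (I : Ideal B) (g : σ → Polynomial B) : Ideal (MvPolynomial σ B) :=
  I.map C ⊔ Ideal.span (Set.range fun i => Polynomial.aeval (X i) (g i))

theorem mem_boxIdeal_iff [Fintype σ] {I : Ideal B} {g : σ → Polynomial B} {f : MvPolynomial σ B} :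
    f ∈ boxIdeal I g ↔
      ∃ h : σ → MvPolynomial σ B, f + ∑ i, Polynomial.aeval (X i) (g i) * h i ∈ I.map C := by
  rw [boxIdeal, Submodule.mem_sup]
  simp only [Ideal.mem_span_range_iff_exists_fun]
  constructor
  · rintro ⟨q, hq, _, ⟨c, rfl⟩, rfl⟩
    refine ⟨fun i => - c i, ?_⟩
    convert hq using 1
    rw [add_assoc, ← Finset.sum_add_distrib]
    simp [mul_comm]
  · rintro ⟨h, hh⟩
    refine ⟨_, hh, _, ⟨fun i => - h i, rfl⟩, ?_⟩
    rw [add_assoc, ← Finset.sum_add_distrib]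
    simp [mul_comm]

theorem isIntegral_mk_boxIdeal (I : Ideal B) {g : σ → Polynomial B} (hg : ∀ i, (g i).Monic)
    (f : MvPolynomial σ B) : IsIntegral B (Ideal.Quotient.mk (boxIdeal I g) f) := by
  induction f using MvPolynomial.induction_on with
  | C b => exact isIntegral_algebraMap
  | add f f' hf hf' => rw [map_add]; exact hf.add hf'
  | mul_X f i hf =>
    rw [map_mul]
    refine hf.mul ⟨g i, hg i, ?_⟩
    have : Polynomial.aeval (X i) (g i) ∈ boxIdeal I g :=
      Ideal.mem_sup_right (Ideal.subset_span ⟨i, rfl⟩)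
    rw [← Ideal.Quotient.eq_zero_iff_mem, Polynomial.aeval_def, Polynomial.hom_eval₂] at this
    exact this

/-- The quotient by the box ideal is integral over `B`, so a prime over the box ideal and strictly
inside `𝔮` would contract strictly inside `I` (incomparability), although it contains `I`. Hence `𝔮`
is minimal over the box ideal, and over a Noetherian ring minimal primes are associated: `𝔮` is the
annihilator of the class of some `c`. -/
theorem exists_mem_iff_mul_mem_boxIdeal [Finite σ] [IsNoetherianRing B] (I : Ideal B)
    {g : σ → Polynomial B} (hg : ∀ i, (g i).Monic) (𝔮 : Ideal (MvPolynomial σ B)) [h𝔮 : 𝔮.IsPrime]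
    (hJ : boxIdeal I g ≤ 𝔮) (hI : 𝔮.comap C = I) :
    ∃ c, ∀ f, f ∈ 𝔮 ↔ f * c ∈ boxIdeal I g := by
  have hmin : 𝔮 ∈ (boxIdeal I g).minimalPrimes := by
    refine ⟨⟨h𝔮, hJ⟩, fun 𝔮' ⟨h𝔮', hJ'⟩ hle x hx => ?_⟩
    by_contra hx'
    obtain ⟨q, hq, hq0⟩ := isIntegral_mk_boxIdeal I hg x
    have hq0' : Polynomial.eval₂ C x q ∈ 𝔮' := by
      refine hJ' (Ideal.Quotient.eq_zero_iff_mem.1 ?_)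
      rw [Polynomial.hom_eval₂]
      exact hq0
    have : Nontrivial (B ⧸ 𝔮'.comap C) :=
      Ideal.Quotient.nontrivial_iff.2 (Ideal.comap_ne_top _ h𝔮'.ne_top)
    have hlt := Ideal.comap_lt_comap_of_root_mem_sdiff hle ⟨hx, hx'⟩
      (Polynomial.map_monic_ne_zero hq) hq0'
    rw [hI] at hlt
    exact hlt.not_ge (Ideal.map_le_iff_le_comap.1 (le_sup_left.trans hJ'))
  have hann : Module.annihilator (MvPolynomial σ B) (MvPolynomial σ B ⧸ boxIdeal I g) =
    boxIdeal I g := Ideal.annihilator_quotient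
  rw [← hann] at hmin
  obtain ⟨-, x, hx⟩ := isAssociatedPrime_iff.1
    (Module.associatedPrimes.minimalPrimes_annihilator_subset_associatedPrimes _ _ hmin)
  obtain ⟨c, rfl⟩ := Ideal.Quotient.mk_surjective x
  refine ⟨c, fun f => ?_⟩
  rw [hx, Submodule.mem_colon_singleton, Submodule.mem_bot,
    ← Ideal.Quotient.eq_zero_iff_mem, map_mul]
  rfl

end Certificate

end MvPolynomial

/-- A proper submodule of a finite free module lies in a maximal one, whose simple quotient is some
`S ⧸ 𝔫`. The `w j` lift the images of the basis vectors. -/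
theorem exists_functional_mod_maximal {S ι : Type*} [CommRing S] [Fintype ι]
    {U : Submodule S (ι → S)}
    (hU : U ≠ ⊤) : ∃ (𝔫 : Ideal S) (w : ι → S), 𝔫.IsMaximal ∧ (∃ j, w j ∉ 𝔫) ∧
      ∀ u ∈ U, ∑ j, u j * w j ∈ 𝔫 := by
  classical
  obtain ⟨W, hW, hUW⟩ := (eq_top_or_exists_le_coatom U).resolve_left hU
  have hs : IsSimpleModule S ((ι → S) ⧸ W) := isSimpleModule_iff_isCoatom.2 hW
  obtain ⟨𝔫, h𝔫, ⟨φ⟩⟩ := isSimpleModule_iff_quot_maximal.1 hs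
  choose w hw using fun j : ι =>
    Ideal.Quotient.mk_surjective (φ (W.mkQ (Pi.single j 1)))
  have key : ∀ u, Ideal.Quotient.mk 𝔫 (∑ j, u j * w j) = φ (W.mkQ u) := by
    intro u
    conv_rhs => rw [pi_eq_sum_univ' u]
    simp only [map_sum, map_mul, hw, map_smul]
    refine Finset.sum_congr rfl fun j _ => ?_
    rw [Algebra.smul_def]
    rfl
  refine ⟨𝔫, w, h𝔫, ?_, fun u hu => ?_⟩
  · by_contra! H
    refine hW.1 (eq_top_iff.2 fun u _ => ?_)
    have : φ (W.mkQ u) = 0 := by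
      rw [← key, Ideal.Quotient.eq_zero_iff_mem]
      exact Ideal.sum_mem _ fun j _ => Ideal.mul_mem_left _ _ (H j)
    rwa [LinearEquiv.map_eq_zero_iff, Submodule.mkQ_apply, Submodule.Quotient.mk_eq_zero] at this
  · rw [← Ideal.Quotient.eq_zero_iff_mem, key, LinearEquiv.map_eq_zero_iff, Submodule.mkQ_apply,
      Submodule.Quotient.mk_eq_zero]
    exact hUW hu

/-! ### Certificates of nonvanishing: soundness and completeness. -/

namespace MvPolynomial

variable {σ B ι κ : Type*} [CommRing B]

/-- The rows of `R` are homogeneous relations between generators of degrees `a`. -/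
def HomogeneousRows (a : ι → ℤ) (R : κ → ι → MvPolynomial σ B) : Prop :=
  ∀ r, ∃ e : ℤ, ∀ j, R r j = 0 ∨ ∃ k : ℕ, (R r j).IsHomogeneous k ∧ a j + k = e

section Dehomogenization

variable (i₀ : σ)

/-- The dehomogenization `X i ↦ X i / X i₀`. -/
noncomputable def dehomogenize :
    MvPolynomial σ B →+* Localization.Away (X i₀ : MvPolynomial σ B) :=
  eval₂Hom ((algebraMap (MvPolynomial σ B) _).comp C)
    fun i => algebraMap (MvPolynomial σ B) _ (X i) * IsLocalization.Away.invSelf (X i₀ : MvPolynomial σ B)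

theorem dehomogenize_of_isHomogeneous {f : MvPolynomial σ B} {k : ℕ} (hf : f.IsHomogeneous k) :
    dehomogenize i₀ f = algebraMap (MvPolynomial σ B) _ f *
      IsLocalization.Away.invSelf (X i₀ : MvPolynomial σ B) ^ k := by
  conv_lhs => rw [f.as_sum]
  conv_rhs => rw [f.as_sum]
  rw [map_sum, map_sum, Finset.sum_mul]
  refine Finset.sum_congr rfl fun e he => ?_
  have hk : ∑ i ∈ e.support, e i = k := by
    rw [← Finsupp.degree_apply, Finsupp.degree_eq_weight_one]
    exact hf (mem_support_iff.1 he)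
  rw [dehomogenize, coe_eval₂Hom, eval₂_monomial, Finsupp.prod]
  simp only [mul_pow]
  rw [Finset.prod_mul_distrib, Finset.prod_pow_eq_pow_sum, hk, monomial_eq, Finsupp.prod, map_mul,
    map_prod, RingHom.comp_apply, mul_assoc]
  simp

/-- Setting `X i₀ = 1` loses nothing of the degree-zero localization. The map `ψ`, semilinear over
dehomogenization, sends the `j`-th basis vector to its class divided by `X i₀ ^ a j`. It kills the
homogeneous relations and the multiples of `X i₀ - 1`, so under `htop` it vanishes, and therefore so
do the localized generators. -/
theorem exists_pow_smul_mem_of_eq_top [Fintype ι] [DecidableEq ι] {a : ι → ℤ}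
    {R : κ → ι → MvPolynomial σ B} (hR : HomogeneousRows a R)
    (htop : Submodule.span (MvPolynomial σ B) (Set.range R) ⊔
      Submodule.span (MvPolynomial σ B) (Set.range fun j : ι => Pi.single j (X i₀ - 1)) = ⊤) (j : ι) :
    ∃ N : ℕ, Pi.single j (X i₀ ^ N) ∈ Submodule.span (MvPolynomial σ B) (Set.range R) := by
  let x : MvPolynomial σ B := X i₀
  let U := Submodule.span (MvPolynomial σ B) (Set.range R)
  let Q := LocalizedModule (Submonoid.powers x) ((ι → MvPolynomial σ B) ⧸ U)
  let L := Localization.Away x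
  let u : Lˣ := ⟨algebraMap _ L x, IsLocalization.Away.invSelf x,
    IsLocalization.Away.mul_invSelf x, (mul_comm _ _).trans (IsLocalization.Away.mul_invSelf x)⟩
  have hu : (↑u⁻¹ : L) = IsLocalization.Away.invSelf x := rfl
  let b : ι → Q := fun j => LocalizedModule.mkLinearMap _ _ (U.mkQ (Pi.single j 1))
  have hb : ∀ v : ι → MvPolynomial σ B, ∑ j, algebraMap (MvPolynomial σ B) L (v j) • b j =
      LocalizedModule.mkLinearMap (Submonoid.powers x) _ (U.mkQ v) := by
    intro v
    conv_rhs => rw [pi_eq_sum_univ' v]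
    simp only [map_sum, map_smul, algebraMap_smul]
    rfl
  let ψ : (ι → MvPolynomial σ B) →ₛₗ[(dehomogenize i₀ : MvPolynomial σ B →+* L)] Q :=
    { toFun := fun v => ∑ j, (dehomogenize i₀ (v j) * ↑(u ^ (- a j))) • b j
      map_add' := fun v w => by
        simp only [Pi.add_apply, map_add, add_mul, add_smul, Finset.sum_add_distrib]
      map_smul' := fun f v => by
        simp only [Pi.smul_apply, smul_eq_mul, map_mul, mul_assoc, mul_smul, Finset.smul_sum] }
  have hψ : ∀ v, ψ v = ∑ j, (dehomogenize i₀ (v j) * ↑(u ^ (- a j))) • b j := fun _ => rfl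
  have hsingle : ∀ j f, ψ (Pi.single j f) = (dehomogenize i₀ f * ↑(u ^ (- a j))) • b j := by
    intro j f
    rw [hψ, Finset.sum_eq_single j]
    · simp
    · intro k _ hk
      simp [hk]
    · simp
  have hker : (⊤ : Submodule (MvPolynomial σ B) (ι → MvPolynomial σ B)) ≤ LinearMap.ker ψ := by
    rw [← htop, sup_le_iff, Submodule.span_le, Submodule.span_le]
    constructor
    · rintro _ ⟨r, rfl⟩
      obtain ⟨e, he⟩ := hR r
      rw [SetLike.mem_coe, LinearMap.mem_ker, hψ]
      -- The degree of an entry and that of its generator add up to `e`, so the image of the row is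
      -- `u ^ (-e)` times the localized relation.
      have : ∀ j, dehomogenize i₀ (R r j) * ↑(u ^ (- a j)) =
          ↑(u ^ (- e)) * algebraMap (MvPolynomial σ B) L (R r j) := by
        intro j
        rcases he j with h | ⟨k, hk, rfl⟩
        · rw [h]; simp
        · rw [dehomogenize_of_isHomogeneous i₀ hk, ← hu, neg_add, zpow_add,
            mul_comm _ (algebraMap (MvPolynomial σ B) L _),
            mul_assoc, zpow_neg u (k : ℤ), zpow_natCast, ← inv_pow, mul_comm (u ^ (- a j))]
          push_cast
          rfl
      simp only [this, mul_smul]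
      rw [← Finset.smul_sum, hb]
      have h0 : U.mkQ (R r) = 0 :=
        (Submodule.Quotient.mk_eq_zero _).2 (Submodule.subset_span ⟨r, rfl⟩)
      rw [h0, map_zero, smul_zero]
    · rintro _ ⟨j, rfl⟩
      rw [SetLike.mem_coe, LinearMap.mem_ker, hsingle]
      have : dehomogenize i₀ (x - 1) = 0 := by
        rw [map_sub, dehomogenize_of_isHomogeneous i₀ (isHomogeneous_X B i₀ : x.IsHomogeneous 1),
          map_one, pow_one,
          IsLocalization.Away.mul_invSelf, sub_self]
      rw [this, zero_mul, zero_smul]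
  have h0 : ψ (Pi.single j 1) = 0 := hker trivial
  rw [hsingle, map_one, one_mul, ← Units.smul_def, smul_eq_zero_iff_eq] at h0
  obtain ⟨⟨_, N, rfl⟩, hN⟩ := (IsLocalizedModule.eq_zero_iff (Submonoid.powers x) _).1 h0
  refine ⟨N, ?_⟩
  change x ^ N • U.mkQ (Pi.single j 1) = 0 at hN
  rw [← map_smul, Submodule.mkQ_apply, Submodule.Quotient.mk_eq_zero,
    ← Pi.single_smul, smul_eq_mul, mul_one] at hN
  exact hN

end Dehomogenization

section NonvanishingCertificate

variable [Fintype σ] [Fintype ι]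

/-- The data `I, s, g, w, h` witness that `X i₀` acts non-nilpotently on the cokernel of `R`: modulo
`I`, the polynomials `w j` satisfy the relations `R` up to multiples of the `g i (X i)`. -/
structure IsNonvanishingCertificate (i₀ : σ) (R : κ → ι → MvPolynomial σ B) (I : Ideal B) (s : B)
    (g : σ → Polynomial B) (w : ι → MvPolynomial σ B) (h : κ → σ → MvPolynomial σ B) : Prop where
  mem_of_mul_mem : ∀ b, s * b ∈ I → b ∈ I
  monic : ∀ i, (g i).Monic
  eq_X_sub_C : g i₀ = Polynomial.X - Polynomial.C s
  relation : ∀ r, ∑ j, R r j * w j + ∑ i, Polynomial.aeval (X i) (g i) * h r i ∈ I.map C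
  reduced : ∀ j i, w j ∈ reducedIn B i (g i).natDegree
  exists_notMem : ∃ j, w j ∉ I.map C

/-- Pairing with `w` sends relations into the box ideal, where `X i₀` is congruent to `s`. If a
power of `X i₀` killed the `j`-th generator, `s ^ N * w j` would lie in the box ideal; being
reduced, it would have all coefficients in `I`, and cancelling `s` would put `w j` there too. -/
theorem IsNonvanishingCertificate.exists_forall_pow_notMem [DecidableEq ι] {i₀ : σ}
    {R : κ → ι → MvPolynomial σ B} {I : Ideal B} {s : B} {g : σ → Polynomial B}
    {w : ι → MvPolynomial σ B} {h : κ → σ → MvPolynomial σ B}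
    (H : IsNonvanishingCertificate i₀ R I s g w h) :
    ∃ j, ∀ N : ℕ, (Pi.single j (X i₀ ^ N) : ι → MvPolynomial σ B) ∉
      Submodule.span (MvPolynomial σ B) (Set.range R) := by
  obtain ⟨j, hj⟩ := H.exists_notMem
  refine ⟨j, fun N hN => hj ?_⟩
  have hspan : ∀ v : ι → MvPolynomial σ B, v ∈ Submodule.span (MvPolynomial σ B) (Set.range R) →
      ∑ j, v j * w j ∈ boxIdeal I g := by
    intro v hv
    induction hv using Submodule.span_induction with
    | mem v hv =>
      obtain ⟨r, rfl⟩ := hv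
      exact mem_boxIdeal_iff.2 ⟨h r, H.relation r⟩
    | zero => simp
    | add v v' _ _ hv hv' =>
      simp only [Pi.add_apply, add_mul, Finset.sum_add_distrib]
      exact Ideal.add_mem _ hv hv'
    | smul f v _ hv =>
      simp only [Pi.smul_apply, smul_eq_mul, mul_assoc, ← Finset.mul_sum]
      exact Ideal.mul_mem_left _ _ hv
  have h1 : X i₀ ^ N * w j ∈ boxIdeal I g := by
    have := hspan _ hN
    rwa [Finset.sum_eq_single j (fun k _ hk => by simp [hk]) (by simp), Pi.single_eq_same] at this
  have hX : X i₀ - C s ∈ boxIdeal I g := by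
    have : Polynomial.aeval (X i₀) (g i₀) ∈ boxIdeal I g :=
      Ideal.mem_sup_right (Ideal.subset_span ⟨i₀, rfl⟩)
    simpa [H.eq_X_sub_C] using this
  have h2 : C (s ^ N) * w j ∈ boxIdeal I g := by
    rw [C_pow]
    have := Ideal.mul_mem_right (w j) _ (Ideal.mem_of_dvd _ (sub_dvd_pow_sub_pow (X i₀) (C s) N) hX)
    rw [sub_mul] at this
    exact (Submodule.sub_mem_iff_right _ h1).1 this
  obtain ⟨q, hq⟩ := mem_boxIdeal_iff.1 h2
  rw [← smul_eq_C_mul] at hq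
  have h3 := mem_map_C_of_reduced g H.monic I Finset.univ
    (fun i _ => Submodule.smul_mem _ _ (H.reduced j i)) q hq
  rw [mem_map_C_iff] at h3 ⊢
  intro e
  have h4 := h3 e
  rw [coeff_smul, smul_eq_mul] at h4
  clear h1 h2 hq h3 hN
  induction N with
  | zero => simpa using h4
  | succ N ih => exact ih (H.mem_of_mul_mem _ (by rwa [← mul_assoc, ← pow_succ']))

theorem exists_isNonvanishingCertificate [DecidableEq ι] [IsNoetherianRing B] {i₀ : σ} {a : ι → ℤ}
    {R : κ → ι → MvPolynomial σ B} (hR : HomogeneousRows a R) {j₀ : ι}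
    (hj₀ : ∀ N : ℕ, (Pi.single j₀ (X i₀ ^ N) : ι → MvPolynomial σ B) ∉
      Submodule.span (MvPolynomial σ B) (Set.range R)) :
    ∃ I s g w h, IsNonvanishingCertificate i₀ R I s g w h := by
  classical
  have hU := mt (fun htop => exists_pow_smul_mem_of_eq_top i₀ hR htop j₀) (by push Not; exact hj₀)
  obtain ⟨𝔫, w, h𝔫, ⟨j₁, hj₁⟩, hw⟩ := exists_functional_mod_maximal hU
  have h𝔫' := h𝔫.isPrime
  -- The functional kills `X i₀ - 1` times the `j₁`-th basis vector, but its value `w j₁` on that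
  -- vector is a unit modulo `𝔫`.
  have hX : X i₀ - 1 ∈ 𝔫 := by
    have := hw (Pi.single j₁ (X i₀ - 1))
      (Submodule.mem_sup_right (Submodule.subset_span ⟨j₁, rfl⟩))
    rw [Finset.sum_eq_single j₁ (fun k _ hk => by simp [hk]) (by simp), Pi.single_eq_same] at this
    exact (h𝔫'.mem_or_mem this).resolve_right hj₁
  obtain ⟨s, hs, hg⟩ := exists_scaled_integral 𝔫
  choose g₀ hg₀ hg₀' using hg
  -- As `X i₀` is congruent to `1` modulo `𝔫`, the scaled coordinate `s * X i₀` is a root of `X - s`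
  -- there; this linear polynomial replaces the one from Zariski's lemma.
  let g := Function.update g₀ i₀ (Polynomial.X - Polynomial.C s)
  have hgi₀ : g i₀ = Polynomial.X - Polynomial.C s := Function.update_self ..
  have hgne : ∀ i, i ≠ i₀ → g i = g₀ i := fun i hi => Function.update_of_ne hi ..
  have hmonic : ∀ i, (g i).Monic := by
    intro i
    by_cases hi : i = i₀
    · rw [hi, hgi₀]; exact Polynomial.monic_X_sub_C s
    · rw [hgne i hi]; exact hg₀ i
  let I := 𝔫.comap C
  let 𝔮 := 𝔫.comap (scaleX σ s)
  have h𝔮 : 𝔮.IsPrime := Ideal.comap_isPrime _ _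
  have hmem𝔮 : ∀ f, f ∈ 𝔮 ↔ scaleX σ s f ∈ 𝔫 := fun f => Ideal.mem_comap
  have hCI : 𝔮.comap C = I := by
    ext b
    rw [Ideal.mem_comap, hmem𝔮, Ideal.mem_comap, ← algebraMap_eq, AlgHom.commutes]
  have hJ : boxIdeal I g ≤ 𝔮 := by
    rw [boxIdeal, sup_le_iff, Ideal.map_le_iff_le_comap, hCI, Ideal.span_le]
    refine ⟨le_rfl, ?_⟩
    rintro _ ⟨i, rfl⟩
    rw [SetLike.mem_coe, hmem𝔮, scaleX_aeval_X]
    by_cases hi : i = i₀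
    · rw [hi, hgi₀, map_sub, Polynomial.aeval_X, Polynomial.aeval_C, algebraMap_eq]
      convert Ideal.mul_mem_left 𝔫 (C s) hX using 1
      ring
    · rw [hgne i hi]
      exact hg₀' i
  obtain ⟨c, hc⟩ := exists_mem_iff_mul_mem_boxIdeal I hmonic 𝔮 hJ hCI
  -- The shift `t` makes every `t + a j` at least the degree of `w j`. Then `s ^ (t + a j) * w j` is
  -- the scaling of some `w₁ j`, and a relation of degree `e` acquires the common factor `s ^ (t +
  -- e)`.
  obtain ⟨t, ht⟩ : ∃ t : ℤ, ∀ j, ((w j).totalDegree : ℤ) ≤ t + a j := by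
    refine ⟨∑ j, |((w j).totalDegree : ℤ) - a j|, fun j => ?_⟩
    have h1 := Finset.single_le_sum (f := fun j => |((w j).totalDegree : ℤ) - a j|)
      (fun j _ => abs_nonneg _) (Finset.mem_univ j)
    have h2 := le_abs_self (((w j).totalDegree : ℤ) - a j)
    linarith
  have hT : ∀ j, ((t + a j).toNat : ℤ) = t + a j := fun j => by have := ht j; omega
  choose w₁ hw₁ using fun j => exists_scaleX_eq s (w j) (k := (t + a j).toNat)
    (by have := ht j; omega)
  have hrel : ∀ r, ∑ j, R r j * w₁ j ∈ 𝔮 := by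
    intro r
    obtain ⟨e, he⟩ := hR r
    rw [hmem𝔮, map_sum]
    have : ∀ j, scaleX σ s (R r j * w₁ j) = C s ^ (t + e).toNat * (R r j * w j) := by
      intro j
      rw [map_mul, hw₁]
      rcases he j with h0 | ⟨k, hk, hke⟩
      · simp [h0]
      · have : (t + e).toNat = k + (t + a j).toNat := by have := hT j; omega
        rw [scaleX_of_isHomogeneous s hk, this, pow_add]
        ring
    simp only [this, ← Finset.mul_sum]
    exact Ideal.mul_mem_left _ _ (hw _ (Submodule.mem_sup_left (Submodule.subset_span ⟨r, rfl⟩)))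
  have hj₁' : w₁ j₁ ∉ 𝔮 := by
    rw [hmem𝔮, hw₁]
    intro h
    exact (h𝔫'.mem_or_mem h).elim (fun h => hs (h𝔫'.mem_of_pow_mem _ h)) hj₁
  -- Multiplication by `c` turns relations modulo `𝔮` into relations modulo the box ideal, and keeps
  -- `w₁ j₁` nonzero there. Reduction then changes the vectors only within the box ideal.
  choose q hq using fun j => exists_reduced g hmonic Finset.univ (w₁ j * c)
  let w₂ := fun j => w₁ j * c + ∑ i, Polynomial.aeval (X i) (g i) * q j i
  have hw₂ : ∀ j, w₂ j - w₁ j * c ∈ boxIdeal I g := fun j => by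
    rw [add_sub_cancel_left]
    exact Ideal.sum_mem _ fun i _ => Ideal.mul_mem_right _ _
      (Ideal.mem_sup_right (Ideal.subset_span ⟨i, rfl⟩))
  have hrel₂ : ∀ r, ∑ j, R r j * w₂ j ∈ boxIdeal I g := by
    intro r
    have h1 := (hc _).1 (hrel r)
    have h2 : ∑ j, R r j * (w₂ j - w₁ j * c) ∈ boxIdeal I g :=
      Ideal.sum_mem _ fun j _ => Ideal.mul_mem_left _ _ (hw₂ j)
    convert Ideal.add_mem _ h1 h2 using 1
    rw [Finset.sum_mul, ← Finset.sum_add_distrib]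
    exact Finset.sum_congr rfl fun j _ => by ring
  choose h hh using fun r => mem_boxIdeal_iff.1 (hrel₂ r)
  refine ⟨I, s, g, w₂, h, ⟨fun b hb => ?_, hmonic, hgi₀, hh, fun j i => hq j i (Finset.mem_univ i),
    j₁, fun hmem => hj₁' ((hc _).2 ?_)⟩⟩
  · rw [Ideal.mem_comap, C_mul] at hb
    exact (h𝔫'.mem_or_mem hb).resolve_left hs
  · exact (Submodule.sub_mem_iff_right _ (Ideal.mem_sup_left hmem)).1 (hw₂ j₁)

end NonvanishingCertificate

end MvPolynomial

/-! ### Computability of polynomial arithmetic; codes of monic and of reduced polynomials. -/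

section Exponents

variable {n : ℕ}

theorem Primrec.pi_single (i : Fin n) : Primrec fun k : ℕ => (Pi.single i k : Fin n → ℕ) := by
  refine Primrec.fin_curry.2 ((Primrec.ite (Primrec.eq.comp Primrec.snd (Primrec.const i))
    Primrec.fst (Primrec.const 0)).of_eq fun a => ?_)
  exact (Pi.single_apply i a.1 a.2).symm

theorem Primrec.pi_add : Primrec₂ fun e e' : Fin n → ℕ => e + e' := by
  refine Primrec.fin_curry.2 ?_
  exact Primrec.nat_add.comp
    (Primrec.fin_app.comp (Primrec.fst.comp Primrec.fst) Primrec.snd)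
    (Primrec.fin_app.comp (Primrec.snd.comp Primrec.fst) Primrec.snd)

theorem Computable.sum_fin : Computable fun e : Fin n → ℕ => ∑ i, e i :=
  (Computable.list_sum Primrec.nat_add.to_comp
    (Primrec.list_ofFn fun i => Primrec.fin_app.comp Primrec.id (Primrec.const i)).to_comp).of_eq
    fun e => by simp [List.sum_ofFn]

end Exponents

namespace PolyCode

variable {B : Type*} [CommRing B] {n : ℕ}

/-- The test whether all coefficients lie in the ideal generated by `P`, given a membership test. -/
def coeffsTest (mem : List B → List B → Bool) (P : List B) (l : PolyCode B n) : Bool :=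
  mem P (l.map fun t => l.coeffAt t.2)

theorem coeffsTest_iff {mem : List B → List B → Bool}
    (hmem : ∀ P L, mem P L = true ↔ ∀ b ∈ L, b ∈ idealOfList P) {P : List B} {l : PolyCode B n} :
    l.coeffsTest mem P = true ↔ toPoly l ∈ (idealOfList P).map MvPolynomial.C := by
  rw [coeffsTest, hmem, List.forall_mem_map, forall_coeffAt_mem_iff]

/-- The monic polynomial with lower coefficients `- G` in the variable `i`. -/
def ofMonic (i : Fin (n + 1)) (G : List B) : PolyCode B n :=
  (1, Pi.single i G.length) ::
    (List.range G.length).map fun k => (-(G.getD k 0), Pi.single i k)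

/-- The test whether all exponents are smaller than the lengths of the lists `G i`. -/
def reducedTest (G : Fin (n + 1) → List B) (l : PolyCode B n) : Bool :=
  l.all fun t => (List.finRange (n + 1)).all fun i => decide (t.2 i < (G i).length)

section Computability

variable [Primcodable B] {α : Type*} [Primcodable α]

theorem computable_mul (hB : IsComputableRing B) :
    Computable₂ fun l l' : PolyCode B n => l.mul l' := by
  refine Computable.list_flatMap Computable.fst (Computable.list_map
    (Computable.snd.comp Computable.fst) ?_)
  refine Computable.pair ?_ ?_
  · exact hB.mul.comp (Computable.fst.comp (Computable.snd.comp Computable.fst))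
      (Computable.fst.comp Computable.snd)
  · exact Primrec.pi_add.to_comp.comp (Computable.snd.comp (Computable.snd.comp Computable.fst))
      (Computable.snd.comp Computable.snd)

theorem computable_coeffAt (hB : IsComputableRing B) :
    Computable₂ fun (l : PolyCode B n) e => l.coeffAt e := by
  refine Computable.list_sum hB.add (Computable.list_map Computable.fst ?_)
  refine (Computable.cond (c := fun a => decide (a.2.2 = a.1.2)) ?_
    (Computable.fst.comp Computable.snd) (Computable.const 0)).of_eq fun a => ?_
  · exact (Primrec.eq.decide.to_comp).comp (Computable.snd.comp Computable.snd)
      (Computable.snd.comp Computable.fst)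
  · simp [Bool.cond_decide]

theorem computable_coeffsTest (hB : IsComputableRing B) {mem : List B → List B → Bool}
    (hmem : Computable₂ mem) :
    Computable₂ fun (P : List B) (l : PolyCode B n) => l.coeffsTest mem P :=
  hmem.comp Computable.fst (Computable.list_map Computable.snd
    ((computable_coeffAt hB).comp (Computable.snd.comp Computable.fst)
      (Computable.snd.comp Computable.snd)).to₂)

theorem computable_ofMonic (hB : IsComputableRing B) (i : Fin (n + 1)) :
    Computable fun G : List B => (ofMonic i G : PolyCode B n) := by
  refine Computable.list_cons.comp ((Computable.const 1).pair
    ((Primrec.pi_single i).to_comp.comp Computable.list_length)) ?_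
  refine Computable.list_map (Primrec.list_range.to_comp.comp Computable.list_length) ?_
  exact (hB.neg.comp (Computable.list_getD 0 Computable.fst Computable.snd)).pair
    ((Primrec.pi_single i).to_comp.comp Computable.snd)

theorem computable_reducedTest {A : Type*} [Primcodable A] :
    Computable₂ fun (G : Fin (n + 1) → List A) (l : PolyCode A n) => l.reducedTest G := by
  refine Computable.list_all Computable.snd (Computable.list_const_all _ fun i => ?_)
  refine Primrec.to_comp (Primrec.nat_lt.decide.comp ?_ ?_)
  · exact Primrec.fin_app.comp (Primrec.snd.comp Primrec.snd) (Primrec.const i)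
  · exact Primrec.list_length.comp
      (Primrec.fin_app.comp (Primrec.fst.comp Primrec.fst) (Primrec.const i))

end Computability

/-- The monic polynomial with lower coefficients `- G`. -/
noncomputable def monicPoly (G : List B) : Polynomial B :=
  Polynomial.X ^ G.length +
    ∑ k ∈ Finset.range G.length, Polynomial.C (-(G.getD k 0)) * Polynomial.X ^ k

theorem degree_monicPoly_tail_lt [Nontrivial B] (G : List B) :
    (∑ k ∈ Finset.range G.length,
      Polynomial.C (-(G.getD k 0)) * Polynomial.X ^ k : Polynomial B).degree < (G.length : ℕ) := by
  refine lt_of_le_of_lt (Polynomial.degree_sum_le _ _) ?_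
  rw [Finset.sup_lt_iff (WithBot.bot_lt_coe _)]
  intro k hk
  exact (Polynomial.degree_C_mul_X_pow_le _ _).trans_lt
    (Nat.cast_lt.2 (Finset.mem_range.1 hk))

theorem monic_monicPoly (G : List B) : (monicPoly G).Monic := by
  nontriviality B
  exact Polynomial.monic_X_pow_add (degree_monicPoly_tail_lt G)

theorem natDegree_monicPoly [Nontrivial B] (G : List B) : (monicPoly G).natDegree = G.length := by
  rw [monicPoly, Polynomial.natDegree_add_eq_left_of_degree_lt, Polynomial.natDegree_X_pow]
  rw [Polynomial.degree_X_pow]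
  exact degree_monicPoly_tail_lt G

theorem exists_monicPoly_eq {g : Polynomial B} (hg : g.Monic) :
    ∃ G : List B, G.length = g.natDegree ∧ monicPoly G = g := by
  refine ⟨List.ofFn fun k : Fin g.natDegree => - g.coeff k, by simp, ?_⟩
  conv_rhs => rw [hg.as_sum]
  rw [monicPoly, List.length_ofFn]
  congr 1
  refine Finset.sum_congr rfl fun k hk => ?_
  simp [Finset.mem_range.1 hk]

theorem toPoly_ofMonic (i : Fin (n + 1)) (G : List B) :
    toPoly (ofMonic i G) = Polynomial.aeval (MvPolynomial.X i) (monicPoly G) := by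
  have hs : ∀ k : ℕ, Finsupp.equivFunOnFinite.symm (Pi.single i k : Fin (n + 1) → ℕ) =
      Finsupp.single i k := fun k => by
    ext j
    simp [Finsupp.single_apply]
  have hmono : ∀ (k : ℕ) (b : B), MvPolynomial.monomial (Finsupp.single i k) b =
      MvPolynomial.C b * MvPolynomial.X i ^ k := fun k b => by
    rw [MvPolynomial.X_pow_eq_monomial, MvPolynomial.C_mul_monomial, mul_one]
  rw [ofMonic, toPoly_cons, toPoly, List.map_map, monicPoly, map_add, map_sum]
  congr 1
  · simp [hs, hmono]
  · rw [Finset.sum_range, ← List.sum_ofFn]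
    congr 1
    refine List.ext_getElem (by simp) fun k _ hk => ?_
    have hk : k < G.length := by simpa using hk
    simp [hs, hmono, hk, MvPolynomial.algebraMap_eq]

theorem mem_reducedIn_of_reducedTest {G : Fin (n + 1) → List B} {l : PolyCode B n}
    (h : l.reducedTest G = true) (i : Fin (n + 1)) :
    toPoly l ∈ MvPolynomial.reducedIn B i (G i).length := by
  intro e he
  by_contra hc
  obtain ⟨t, ht, hte⟩ := exists_mem_of_coeff_ne_zero hc
  have := List.all_eq_true.1 h t ht
  have := of_decide_eq_true (List.all_eq_true.1 this i (List.mem_finRange i))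
  rw [hte] at this
  omega

theorem exists_reducedTest {G : Fin (n + 1) → List B} {f : MvPolynomial (Fin (n + 1)) B}
    (hf : ∀ i, f ∈ MvPolynomial.reducedIn B i (G i).length) :
    ∃ l : PolyCode B n, toPoly l = f ∧ l.reducedTest G = true := by
  obtain ⟨l, rfl, hl⟩ := exists_toPoly_eq f
  refine ⟨l, rfl, List.all_eq_true.2 fun t ht => List.all_eq_true.2 fun i _ => ?_⟩
  refine decide_eq_true ?_
  by_contra hc
  exact hl t ht (hf i _ (not_lt.1 hc))

end PolyCode

/-! ### The tests for inhomogeneity, nilpotency and nonvanishing, and their computability. -/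

namespace PresentationCode

variable {B : Type*} [CommRing B] {n : ℕ}

/-- The `j`-th entry of the `r`-th relation. -/
def entry (c : PresentationCode B n) (r j : ℕ) : PolyCode B n := (c.2.getD r []).getD j []

theorem mat_apply (c : PresentationCode B n) (r : Fin c.2.length) (j : Fin c.1.length) :
    c.mat r j = (c.entry r j).toPoly := by
  simp [mat, entry]

/-- The test whether the coefficients of the monomials with exponents `e` and `e'` in the entries
`(r, j)` and `(r, j')` contradict the homogeneity of the presentation. -/
def inhomogeneityTest (mem : List B → List B → Bool) (c : PresentationCode B n)
    (t : ℕ × (ℕ × (Fin (n + 1) → ℕ)) × (ℕ × (Fin (n + 1) → ℕ))) : Bool :=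
  decide (t.1 < c.2.length) && decide (t.2.1.1 < c.1.length) && decide (t.2.2.1 < c.1.length) &&
    !mem [] [(c.entry t.1 t.2.1.1).coeffAt t.2.1.2] &&
    !mem [] [(c.entry t.1 t.2.2.1).coeffAt t.2.2.2] &&
    -- This compares the two total degrees, generator degree plus exponent sum, with negative parts
    -- moved to the other side to stay in `ℕ`.
    !decide ((c.1.getD t.2.1.1 0).toNat + (-(c.1.getD t.2.2.1 0)).toNat + ∑ i, t.2.1.2 i =
      (c.1.getD t.2.2.1 0).toNat + (-(c.1.getD t.2.1.1 0)).toNat + ∑ i, t.2.2.2 i)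

/-- The entry at `(j, j')` of the difference of `X * c.mat` and the scalar matrix
`x ^ N`, where `x` is the `i`-th variable and `t = (N, X)`. -/
def powerResidual (i : Fin (n + 1)) (c : PresentationCode B n)
    (t : ℕ × List (List (PolyCode B n))) (j j' : ℕ) : PolyCode B n :=
  ((List.range c.2.length).flatMap fun r =>
    PolyCode.mul ((t.2.getD j []).getD r []) (c.entry r j')) ++
    bif decide (j = j') then [(-1, Pi.single i t.1)] else []

/-- The test whether `t.2` is a matrix whose product with the presentation matrix is
`X i ^ t.1`. -/
def powerTest (mem : List B → List B → Bool) (i : Fin (n + 1)) (c : PresentationCode B n)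
    (t : ℕ × List (List (PolyCode B n))) : Bool :=
  (List.range c.1.length).all fun j => (List.range c.1.length).all fun j' =>
    PolyCode.coeffsTest mem [] (c.powerResidual i t j j')

/-- Codes of the data of an `IsNonvanishingCertificate`. -/
abbrev CertificateCode (B : Type*) (n : ℕ) : Type _ :=
  (List B × (Fin (n + 1) → List B)) × (List (PolyCode B n) × List (Fin (n + 1) → PolyCode B n)) ×
    ℕ × (Fin (n + 1) → ℕ)

/-- The combination of the `r`-th relation and the monic polynomials given by a certificate. -/
def certificateRelation (c : PresentationCode B n) (t : CertificateCode B n) (r : ℕ) :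
    PolyCode B n :=
  ((List.range c.1.length).flatMap fun j => PolyCode.mul (c.entry r j) (t.2.1.1.getD j [])) ++
    (List.finRange (n + 1)).flatMap fun k =>
      PolyCode.mul (PolyCode.ofMonic k (t.1.2 k)) ((t.2.1.2.getD r fun _ => []) k)

/-- The test whether the data form an `IsNonvanishingCertificate`. -/
def certificateTest (mem : List B → List B → Bool) (nzd : List B → B → Bool) (i : Fin (n + 1))
    (c : PresentationCode B n) (t : CertificateCode B n) : Bool :=
  -- Length one makes the `i`-th monic polynomial `X - s` with `s` the single entry, so `s` need not
  -- be coded separately.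
  nzd t.1.1 ((t.1.2 i).getD 0 0) && decide ((t.1.2 i).length = 1) &&
    ((List.range c.2.length).all fun r =>
      PolyCode.coeffsTest mem t.1.1 (c.certificateRelation t r)) &&
    ((List.range c.1.length).all fun j => PolyCode.reducedTest t.1.2 (t.2.1.1.getD j [])) &&
    decide (t.2.2.1 < c.1.length) &&
    -- The last two components of the code point at an index and an exponent where some `w j` has a
    -- coefficient outside the ideal.
    !mem t.1.1 [(t.2.1.1.getD t.2.2.1 []).coeffAt t.2.2.2]

section Computability

variable [Primcodable B] {α : Type*} [Primcodable α]

theorem computable_entry {A : Type*} [Primcodable A] {c : α → PresentationCode A n} {r j : α → ℕ}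
    (hc : Computable c) (hr : Computable r) (hj : Computable j) :
    Computable fun a => (c a).entry (r a) (j a) :=
  Computable.list_getD [] (Computable.list_getD [] (Computable.snd.comp hc) hr) hj

theorem computable_decide_lt {f g : α → ℕ} (hf : Computable f) (hg : Computable g) :
    Computable fun a => decide (f a < g a) :=
  Primrec.nat_lt.decide.to_comp.comp hf hg

theorem computable_decide_eq {f g : α → ℕ} (hf : Computable f) (hg : Computable g) :
    Computable fun a => decide (f a = g a) :=
  (Primrec.eq (α := ℕ)).decide.to_comp.comp hf hg

theorem computable_and {f g : α → Bool} (hf : Computable f) (hg : Computable g) :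
    Computable fun a => f a && g a :=
  Primrec.and.to_comp.comp hf hg

theorem computable_not {f : α → Bool} (hf : Computable f) : Computable fun a => !f a :=
  Primrec.not.to_comp.comp hf

theorem computable_notMem {A : Type*} [Primcodable A] {mem : List A → List A → Bool}
    (hmem : Computable₂ mem) {P : α → List A} {b : α → A} (hP : Computable P) (hb : Computable b) :
    Computable fun a => !mem (P a) [b a] :=
  computable_not (hmem.comp hP (Computable.list_cons.comp hb (Computable.const [])))

theorem computable_inhomogeneityTest (hB : IsComputableRing B) {mem : List B → List B → Bool}
    (hmem : Computable₂ mem) : Computable₂ (inhomogeneityTest (n := n) mem) := by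
  let T := ℕ × (ℕ × (Fin (n + 1) → ℕ)) × (ℕ × (Fin (n + 1) → ℕ))
  have hc : Computable (Prod.fst : PresentationCode B n × T → _) := Computable.fst
  have hr : Computable fun a : PresentationCode B n × T => a.2.1 :=
    Computable.fst.comp Computable.snd
  have h1 : Computable fun a : PresentationCode B n × T => a.2.2.1 :=
    Computable.fst.comp (Computable.snd.comp Computable.snd)
  have h2 : Computable fun a : PresentationCode B n × T => a.2.2.2 :=
    Computable.snd.comp (Computable.snd.comp Computable.snd)
  have hp : Computable fun a : PresentationCode B n × T => a.1.1.length :=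
    Computable.list_length.comp (Computable.fst.comp hc)
  have hm : Computable fun a : PresentationCode B n × T => a.1.2.length :=
    Computable.list_length.comp (Computable.snd.comp hc)
  have hj := Computable.fst.comp h1
  have hj' := Computable.fst.comp h2
  have he := Computable.snd.comp h1
  have he' := Computable.snd.comp h2
  have hd := Computable.list_getD 0 (Computable.fst.comp hc) hj
  have hd' := Computable.list_getD 0 (Computable.fst.comp hc) hj'
  have hadd := Primrec.nat_add.to_comp
  have hpos := Primrec.int_toNat.to_comp
  have hneg := Primrec.int_neg_toNat.to_comp
  refine computable_and (computable_and (computable_and (computable_and (computable_and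
    (computable_decide_lt hr hm) (computable_decide_lt hj hp)) (computable_decide_lt hj' hp))
    (computable_notMem hmem (Computable.const [])
      ((PolyCode.computable_coeffAt hB).comp (computable_entry hc hr hj) he)))
    (computable_notMem hmem (Computable.const [])
      ((PolyCode.computable_coeffAt hB).comp (computable_entry hc hr hj') he')))
    (computable_not (computable_decide_eq
      (hadd.comp (hadd.comp (hpos.comp hd) (hneg.comp hd')) (Computable.sum_fin.comp he))
      (hadd.comp (hadd.comp (hpos.comp hd') (hneg.comp hd)) (Computable.sum_fin.comp he'))))

theorem computable_powerResidual (hB : IsComputableRing B) (i : Fin (n + 1))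
    {c : α → PresentationCode B n} {t : α → ℕ × List (List (PolyCode B n))} {j j' : α → ℕ}
    (hc : Computable c) (ht : Computable t) (hj : Computable j) (hj' : Computable j') :
    Computable fun a => (c a).powerResidual i (t a) (j a) (j' a) := by
  have h1 : Computable₂ fun (a : α) (r : ℕ) => (((t a).2.getD (j a) []).getD r [] : PolyCode B n) :=
    (Computable.list_getD [] (Computable.list_getD []
      (Computable.snd.comp (ht.comp Computable.fst)) (hj.comp Computable.fst)) Computable.snd).to₂
  have h2 : Computable₂ fun (a : α) (r : ℕ) => (c a).entry r (j' a) :=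
    (computable_entry (hc.comp Computable.fst) Computable.snd (hj'.comp Computable.fst)).to₂
  have h3 : Computable₂ fun (a : α) (r : ℕ) =>
      PolyCode.mul (((t a).2.getD (j a) []).getD r []) ((c a).entry r (j' a)) :=
    (PolyCode.computable_mul hB).comp₂ h1 h2
  have hm : Computable fun a => (c a).2.length :=
    Computable.list_length.comp (Computable.snd.comp hc)
  have h4 : Computable fun a => ([(-1, Pi.single i (t a).1)] : PolyCode B n) :=
    Computable.list_cons.comp ((Computable.const (-1)).pair
      ((Primrec.pi_single i).to_comp.comp (Computable.fst.comp ht))) (Computable.const [])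
  have h5 := Computable.cond (computable_decide_eq hj hj') h4 (Computable.const [])
  exact Computable.list_append.comp (Computable.list_range_flatMap hm h3) h5

theorem computable_powerTest (hB : IsComputableRing B) {mem : List B → List B → Bool}
    (hmem : Computable₂ mem) (i : Fin (n + 1)) : Computable₂ (powerTest mem i) := by
  have h1 : Computable fun a : ((PresentationCode B n × ℕ × List (List (PolyCode B n))) × ℕ) × ℕ =>
      a.1.1.1.powerResidual i a.1.1.2 a.1.2 a.2 :=
    computable_powerResidual hB i
      (Computable.fst.comp (Computable.fst.comp Computable.fst))
      (Computable.snd.comp (Computable.fst.comp Computable.fst))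
      (Computable.snd.comp Computable.fst) Computable.snd
  have h2 : Computable fun a : ((PresentationCode B n × ℕ × List (List (PolyCode B n))) × ℕ) × ℕ =>
      PolyCode.coeffsTest mem [] (a.1.1.1.powerResidual i a.1.1.2 a.1.2 a.2) :=
    (PolyCode.computable_coeffsTest hB hmem).comp (Computable.const []) h1
  have hp : Computable fun a : PresentationCode B n × ℕ × List (List (PolyCode B n)) =>
      a.1.1.length := Computable.list_length.comp (Computable.fst.comp Computable.fst)
  exact Computable.list_range_all hp
    (Computable.list_range_all (hp.comp Computable.fst) h2.to₂).to₂

theorem computable_certificateRelation (hB : IsComputableRing B)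
    {c : α → PresentationCode B n} {P : α → List B} {G : α → Fin (n + 1) → List B}
    {w : α → List (PolyCode B n)} {h : α → List (Fin (n + 1) → PolyCode B n)}
    {e : α → ℕ × (Fin (n + 1) → ℕ)} {r : α → ℕ}
    (hc : Computable c) (hG : Computable G) (hw : Computable w) (hh : Computable h)
    (hr : Computable r) :
    Computable fun a => (c a).certificateRelation ((P a, G a), (w a, h a), e a) (r a) := by
  have hp : Computable fun a => (c a).1.length :=
    Computable.list_length.comp (Computable.fst.comp hc)
  have h1 : Computable₂ fun (a : α) (j : ℕ) => (c a).entry (r a) j :=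
    (computable_entry (hc.comp Computable.fst) (hr.comp Computable.fst) Computable.snd).to₂
  have h2 : Computable₂ fun (a : α) (j : ℕ) => (w a).getD j [] :=
    (Computable.list_getD [] (hw.comp Computable.fst) Computable.snd).to₂
  have h3 : Computable₂ fun (a : α) (j : ℕ) =>
      PolyCode.mul ((c a).entry (r a) j) ((w a).getD j []) :=
    (PolyCode.computable_mul hB).comp₂ h1 h2
  have h4 : ∀ k, Computable fun a => PolyCode.ofMonic k (G a k) := fun k =>
    (PolyCode.computable_ofMonic hB k).comp (Computable.fin_app.comp hG (Computable.const k))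
  have h5 : ∀ k, Computable fun a => ((h a).getD (r a) fun _ => []) k := fun k =>
    Computable.fin_app.comp (Computable.list_getD _ hh hr) (Computable.const k)
  exact Computable.list_append.comp (Computable.list_range_flatMap hp h3)
    (Computable.list_const_flatMap _ fun k => (PolyCode.computable_mul hB).comp (h4 k) (h5 k))

theorem computable_certificateTest (hB : IsComputableRing B) {mem : List B → List B → Bool}
    (hmem : Computable₂ mem) {nzd : List B → B → Bool} (hnzd : Computable₂ nzd) (i : Fin (n + 1)) :
    Computable₂ (certificateTest mem nzd i) := by
  have hc : Computable (Prod.fst : PresentationCode B n × CertificateCode B n → _) := Computable.fst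
  have hP : Computable fun a : PresentationCode B n × CertificateCode B n => a.2.1.1 :=
    Computable.fst.comp (Computable.fst.comp Computable.snd)
  have hG : Computable fun a : PresentationCode B n × CertificateCode B n => a.2.1.2 :=
    Computable.snd.comp (Computable.fst.comp Computable.snd)
  have hGi : Computable fun a : PresentationCode B n × CertificateCode B n => a.2.1.2 i :=
    Computable.fin_app.comp hG (Computable.const i)
  have hw : Computable fun a : PresentationCode B n × CertificateCode B n => a.2.2.1.1 :=
    Computable.fst.comp (Computable.fst.comp (Computable.snd.comp Computable.snd))
  have hh : Computable fun a : PresentationCode B n × CertificateCode B n => a.2.2.1.2 :=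
    Computable.snd.comp (Computable.fst.comp (Computable.snd.comp Computable.snd))
  have hj : Computable fun a : PresentationCode B n × CertificateCode B n => a.2.2.2.1 :=
    Computable.fst.comp (Computable.snd.comp (Computable.snd.comp Computable.snd))
  have he : Computable fun a : PresentationCode B n × CertificateCode B n => a.2.2.2.2 :=
    Computable.snd.comp (Computable.snd.comp (Computable.snd.comp Computable.snd))
  have hp : Computable fun a : PresentationCode B n × CertificateCode B n => a.1.1.length :=
    Computable.list_length.comp (Computable.fst.comp hc)
  have hm : Computable fun a : PresentationCode B n × CertificateCode B n => a.1.2.length :=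
    Computable.list_length.comp (Computable.snd.comp hc)
  have h1 : Computable fun a : PresentationCode B n × CertificateCode B n =>
      nzd a.2.1.1 ((a.2.1.2 i).getD 0 0) :=
    hnzd.comp hP (Computable.list_getD 0 hGi (Computable.const 0))
  have h2 : Computable fun a : PresentationCode B n × CertificateCode B n =>
      decide ((a.2.1.2 i).length = 1) :=
    computable_decide_eq (Computable.list_length.comp hGi) (Computable.const 1)
  have h3 : Computable fun a : (PresentationCode B n × CertificateCode B n) × ℕ =>
      a.1.1.certificateRelation a.1.2 a.2 :=
    computable_certificateRelation hB (P := fun a => a.1.2.1.1) (e := fun a => a.1.2.2.2)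
      (hc.comp Computable.fst) (hG.comp Computable.fst)
      (hw.comp Computable.fst) (hh.comp Computable.fst) Computable.snd
  have h4 : Computable₂ fun (a : PresentationCode B n × CertificateCode B n) (r : ℕ) =>
      PolyCode.coeffsTest mem a.2.1.1 (a.1.certificateRelation a.2 r) :=
    ((PolyCode.computable_coeffsTest hB hmem).comp (hP.comp Computable.fst) h3).to₂
  have h5 : Computable₂ fun (a : PresentationCode B n × CertificateCode B n) (j : ℕ) =>
      PolyCode.reducedTest a.2.1.2 (a.2.2.1.1.getD j []) :=
    (PolyCode.computable_reducedTest.comp (hG.comp Computable.fst)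
      (Computable.list_getD [] (hw.comp Computable.fst) Computable.snd)).to₂
  have h6 : Computable fun a : PresentationCode B n × CertificateCode B n =>
      !mem a.2.1.1 [(a.2.2.1.1.getD a.2.2.2.1 []).coeffAt a.2.2.2.2] :=
    computable_notMem hmem hP ((PolyCode.computable_coeffAt hB).comp
      (Computable.list_getD [] hw hj) he)
  exact computable_and (computable_and (computable_and (computable_and (computable_and h1 h2)
    (Computable.list_range_all hm h4)) (Computable.list_range_all hp h5))
    (computable_decide_lt hj hp)) h6

end Computability

end PresentationCode

/-! ### Correctness of the tests. -/

theorem idealOfList_nil (B : Type*) [CommRing B] : idealOfList ([] : List B) = ⊥ := by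
  simp [idealOfList]

namespace PresentationCode

variable {B : Type*} [CommRing B] {n : ℕ}

/-- Inhomogeneity of a row is always visible on two monomials of different total degree, which makes
it a finite witness. This lets the later search stop on malformed input as well. -/
theorem exists_inhomogeneityTest_iff {mem : List B → List B → Bool}
    (hmem : ∀ P L, mem P L = true ↔ ∀ b ∈ L, b ∈ idealOfList P) (c : PresentationCode B n) :
    (∃ t, inhomogeneityTest mem c t = true) ↔ ¬ c.IsHomogeneous := by
  have hne : ∀ b : B, (!mem [] [b]) = true ↔ b ≠ 0 := fun b => by
    rw [Bool.not_eq_true', ← Bool.not_eq_true, hmem, idealOfList_nil]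
    simp
  have hcoeff : ∀ (r : Fin c.2.length) (j : Fin c.1.length) (e : Fin (n + 1) → ℕ),
      (c.entry r j).coeffAt e = (c.mat r j).coeff (Finsupp.equivFunOnFinite.symm e) :=
    fun r j e => by rw [mat_apply, PolyCode.coeff_toPoly]
  have hdeg : ∀ j : Fin c.1.length, c.1.getD j 0 = c.deg j := fun j => by simp [deg]
  have hint : ∀ (a a' : ℤ) (k k' : ℕ),
      a.toNat + (-a').toNat + k = a'.toNat + (-a).toNat + k' ↔ a + k = a' + k' := by
    intro a a' k k'; omega
  have hkey : (∃ t, inhomogeneityTest mem c t = true) ↔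
      ∃ (r : Fin c.2.length) (j j' : Fin c.1.length) (e e' : Fin (n + 1) → ℕ),
        (c.mat r j).coeff (Finsupp.equivFunOnFinite.symm e) ≠ 0 ∧
        (c.mat r j').coeff (Finsupp.equivFunOnFinite.symm e') ≠ 0 ∧
        c.deg j + (∑ i, e i : ℕ) ≠ c.deg j' + (∑ i, e' i : ℕ) := by
    simp only [inhomogeneityTest, Bool.and_eq_true, hne, decide_eq_true_eq, Bool.not_eq_true',
      decide_eq_false_iff_not, hint]
    constructor
    · rintro ⟨⟨r, ⟨j, e⟩, ⟨j', e'⟩⟩, ⟨⟨⟨⟨hr, hj⟩, hj'⟩, h1⟩, h2⟩, h3⟩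
      refine ⟨⟨r, hr⟩, ⟨j, hj⟩, ⟨j', hj'⟩, e, e', ?_, ?_, ?_⟩
      · rwa [← hcoeff]
      · rwa [← hcoeff]
      · rwa [← hdeg, ← hdeg]
    · rintro ⟨r, j, j', e, e', h1, h2, h3⟩
      rw [← hcoeff] at h1 h2
      rw [← hdeg, ← hdeg] at h3
      exact ⟨⟨r, ⟨j, e⟩, ⟨j', e'⟩⟩, ⟨⟨⟨⟨r.2, j.2⟩, j'.2⟩, h1⟩, h2⟩, h3⟩
  have hsum : ∀ e : Fin (n + 1) →₀ ℕ, Finsupp.weight 1 e = ∑ i, e i := fun e => by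
    rw [← Finsupp.degree_eq_sum, Finsupp.degree_eq_weight_one]
    rfl
  rw [hkey]
  constructor
  · rintro ⟨r, j, j', e, e', h1, h2, h3⟩ hc
    obtain ⟨d, hd⟩ := hc r
    have : ∀ (j : Fin c.1.length) (e : Fin (n + 1) → ℕ),
        (c.mat r j).coeff (Finsupp.equivFunOnFinite.symm e) ≠ 0 →
        c.deg j + (∑ i, e i : ℕ) = d := by
      intro j e h
      rcases hd j with h0 | ⟨k, hk, rfl⟩
      · exact absurd (by rw [h0, MvPolynomial.coeff_zero]) h
      · rw [← hk h, hsum]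
        rfl
    exact h3 ((this j e h1).trans (this j' e' h2).symm)
  · intro hc
    by_contra! H
    refine hc fun r => ?_
    by_cases h0 : ∀ j, c.mat r j = 0
    · exact ⟨0, fun j => Or.inl (h0 j)⟩
    · push Not at h0
      obtain ⟨j₀, hj₀⟩ := h0
      obtain ⟨e₀, he₀⟩ := MvPolynomial.ne_zero_iff.1 hj₀
      have hall : ∀ (j : Fin c.1.length) (e : Fin (n + 1) →₀ ℕ), (c.mat r j).coeff e ≠ 0 →
          c.deg j + (∑ i, e i : ℕ) = c.deg j₀ + (∑ i, e₀ i : ℕ) := by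
        intro j e h
        refine H r j j₀ e e₀ ?_ ?_
        · convert h
          ext; rfl
        · convert he₀
          ext; rfl
      refine ⟨c.deg j₀ + (∑ i, e₀ i : ℕ), fun j => or_iff_not_imp_left.2 fun hj => ?_⟩
      obtain ⟨e₁, he₁⟩ := MvPolynomial.ne_zero_iff.1 hj
      refine ⟨∑ i, e₁ i, fun e he => ?_, hall j e₁ he₁⟩
      have := (hall j e he).trans (hall j e₁ he₁).symm
      change Finsupp.weight 1 e = _
      rw [hsum]
      omega

theorem toPoly_range_flatMap {m : ℕ} (f g : ℕ → PolyCode B n) :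
    PolyCode.toPoly ((List.range m).flatMap fun r => PolyCode.mul (f r) (g r)) =
      ∑ r : Fin m, (f r).toPoly * (g r).toPoly := by
  rw [PolyCode.toPoly_flatMap, ← Finset.sum_range fun r => (f r).toPoly * (g r).toPoly,
    Finset.sum_range, ← List.sum_ofFn]
  congr 1
  exact List.ext_getElem (by simp) fun k _ _ => by simp [PolyCode.toPoly_mul]

theorem toPoly_powerResidual (i : Fin (n + 1)) (c : PresentationCode B n)
    (t : ℕ × List (List (PolyCode B n))) (j j' : Fin c.1.length) :
    (c.powerResidual i t j j').toPoly =
      ∑ r : Fin c.2.length, ((t.2.getD j []).getD r []).toPoly * c.mat r j' -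
        (Pi.single j (MvPolynomial.X i ^ t.1) : Fin c.1.length → MvPolynomial _ B) j' := by
  rw [powerResidual, PolyCode.toPoly_append, toPoly_range_flatMap, sub_eq_add_neg]
  simp only [mat_apply]
  congr 1
  by_cases h : j = j'
  · subst h
    have hs : Finsupp.equivFunOnFinite.symm (Pi.single i t.1 : Fin (n + 1) → ℕ) =
        Finsupp.single i t.1 := by
      ext k
      simp [Finsupp.single_apply]
    simp [PolyCode.toPoly_cons, PolyCode.toPoly_nil, hs, MvPolynomial.X_pow_eq_monomial]
  · have h' : (j : ℕ) ≠ j' := fun hj => h (Fin.ext hj)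
    simp [h', Pi.single_eq_of_ne (Ne.symm h), PolyCode.toPoly_nil]

theorem exists_powerTest_iff {mem : List B → List B → Bool}
    (hmem : ∀ P L, mem P L = true ↔ ∀ b ∈ L, b ∈ idealOfList P) (i : Fin (n + 1))
    (c : PresentationCode B n) :
    (∃ t, powerTest mem i c t = true) ↔ ∀ j, ∃ N : ℕ,
      (Pi.single j (MvPolynomial.X i ^ N) : Fin c.1.length → MvPolynomial (Fin (n + 1)) B) ∈
        Submodule.span (MvPolynomial (Fin (n + 1)) B) (Set.range c.mat) := by
  have hkey : ∀ t, powerTest mem i c t = true ↔ ∀ j : Fin c.1.length,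
      ∑ r : Fin c.2.length, ((t.2.getD j []).getD r []).toPoly • c.mat r =
        Pi.single j (MvPolynomial.X i ^ t.1) := by
    intro t
    simp only [powerTest, List.all_eq_true, List.mem_range, PolyCode.coeffsTest_iff hmem,
      idealOfList_nil, Ideal.map_bot, Ideal.mem_bot]
    rw [Fin.forall_iff]
    refine forall₂_congr fun j hj => ?_
    rw [funext_iff, Fin.forall_iff]
    refine forall₂_congr fun j' hj' => ?_
    rw [toPoly_powerResidual i c t ⟨j, hj⟩ ⟨j', hj'⟩, sub_eq_zero, Finset.sum_apply]
    rfl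
  simp only [hkey]
  constructor
  · rintro ⟨t, ht⟩ j
    exact ⟨t.1, (Submodule.mem_span_range_iff_exists_fun _).2 ⟨_, ht j⟩⟩
  · intro H
    choose N hN using H
    -- The test uses a single exponent for all generators; the sum of the individual ones dominates
    -- each.
    have hN' : ∀ j, (Pi.single j (MvPolynomial.X i ^ (∑ j, N j)) :
        Fin c.1.length → MvPolynomial (Fin (n + 1)) B) ∈
        Submodule.span (MvPolynomial (Fin (n + 1)) B) (Set.range c.mat) := by
      intro j
      have hle := Finset.single_le_sum (f := N) (fun _ _ => Nat.zero_le _) (Finset.mem_univ j)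
      have := Submodule.smul_mem _ (MvPolynomial.X i ^ (∑ j, N j - N j)) (hN j)
      rwa [← Pi.single_smul, smul_eq_mul, ← pow_add, Nat.sub_add_cancel hle] at this
    choose x hx using fun j => (Submodule.mem_span_range_iff_exists_fun _).1 (hN' j)
    choose y hy using fun j r => PolyCode.exists_toPoly_eq (x j r)
    refine ⟨(∑ j, N j, List.ofFn fun j => List.ofFn fun r => y j r), fun j => ?_⟩
    rw [← hx j]
    exact Finset.sum_congr rfl fun r _ => by simp [(hy j r).1]

theorem toPoly_certificateRelation (c : PresentationCode B n) (t : CertificateCode B n)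
    (r : Fin c.2.length) :
    (c.certificateRelation t r).toPoly =
      ∑ j, c.mat r j * (t.2.1.1.getD j []).toPoly +
        ∑ k, Polynomial.aeval (MvPolynomial.X k) (PolyCode.monicPoly (t.1.2 k)) *
          ((t.2.1.2.getD r fun _ => []) k).toPoly := by
  rw [certificateRelation, PolyCode.toPoly_append, toPoly_range_flatMap, PolyCode.toPoly_flatMap]
  simp only [mat_apply, PolyCode.toPoly_mul, PolyCode.toPoly_ofMonic]
  simp only [← List.sum_ofFn, List.ofFn_eq_map]

theorem exists_certificateTest_iff [IsNoetherianRing B] {mem : List B → List B → Bool}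
    (hmem : ∀ P L, mem P L = true ↔ ∀ b ∈ L, b ∈ idealOfList P) {nzd : List B → B → Bool}
    (hnzd : ∀ P s, nzd P s = true ↔ ∀ b, s * b ∈ idealOfList P → b ∈ idealOfList P)
    (i : Fin (n + 1)) (c : PresentationCode B n) :
    (∃ t, certificateTest mem nzd i c t = true) ↔
      ∃ I s g w h, MvPolynomial.IsNonvanishingCertificate i c.mat I s g w h := by
  have hne : ∀ P b, (!mem P [b]) = true ↔ b ∉ idealOfList P := fun P b => by
    rw [Bool.not_eq_true', ← Bool.not_eq_true, hmem]
    simp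
  have hkey : ∀ t, certificateTest mem nzd i c t = true ↔
      (∀ b, (t.1.2 i).getD 0 0 * b ∈ idealOfList t.1.1 → b ∈ idealOfList t.1.1) ∧
      (t.1.2 i).length = 1 ∧
      (∀ r : Fin c.2.length, (c.certificateRelation t r).toPoly ∈
        (idealOfList t.1.1).map MvPolynomial.C) ∧
      (∀ j : Fin c.1.length, PolyCode.reducedTest t.1.2 (t.2.1.1.getD j []) = true) ∧
      ∃ hj : t.2.2.1 < c.1.length,
        (t.2.1.1.getD (⟨t.2.2.1, hj⟩ : Fin c.1.length) []).toPoly.coeff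
          (Finsupp.equivFunOnFinite.symm t.2.2.2) ∉ idealOfList t.1.1 := by
    intro t
    simp only [certificateTest, Bool.and_eq_true, hnzd, List.all_eq_true, List.mem_range,
      PolyCode.coeffsTest_iff hmem, decide_eq_true_eq, hne, and_assoc, exists_prop, Fin.forall_iff,
      PolyCode.coeff_toPoly]
  simp only [hkey, toPoly_certificateRelation]
  constructor
  · rintro ⟨⟨⟨P, G⟩, ⟨w, h⟩, j, e⟩, h1, h2, h3, h4, hj, h5⟩
    -- A coefficient outside an ideal excludes the zero ring, where the degree of a monic polynomial
    -- is not the length of its code.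
    have hnt : Nontrivial B := (subsingleton_or_nontrivial B).resolve_left
      fun _ => h5 ((congrArg (· ∈ idealOfList P) (Subsingleton.elim (0 : B) _)).mp
        (Ideal.zero_mem _))
    refine ⟨idealOfList P, (G i).getD 0 0, fun k => PolyCode.monicPoly (G k),
      fun j => (w.getD j []).toPoly, fun r k => ((h.getD r fun _ => []) k).toPoly, h1,
      fun k => PolyCode.monic_monicPoly _, ?_, h3, fun j k => ?_, ⟨j, hj⟩, fun hmem => ?_⟩
    · dsimp only at h2
      simp [PolyCode.monicPoly, h2, sub_eq_add_neg]
    · rw [PolyCode.natDegree_monicPoly]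
      exact PolyCode.mem_reducedIn_of_reducedTest (h4 j) k
    · exact h5 (MvPolynomial.mem_map_C_iff.1 hmem _)
  · rintro ⟨I, s, g, w, h, H⟩
    obtain ⟨j, hj⟩ := H.exists_notMem
    rw [MvPolynomial.mem_map_C_iff] at hj
    push Not at hj
    obtain ⟨e, he⟩ := hj
    have hnt : Nontrivial B := (subsingleton_or_nontrivial B).resolve_left
      fun _ => he ((congrArg (· ∈ I) (Subsingleton.elim (0 : B) _)).mp (Ideal.zero_mem _))
    obtain ⟨P, rfl⟩ : ∃ P : List B, idealOfList P = I := by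
      obtain ⟨s, hs⟩ := (isNoetherianRing_iff_ideal_fg B).1 inferInstance I
      refine ⟨s.toList, ?_⟩
      rw [← hs, idealOfList]
      congr 1
      ext b
      simp
    choose G hG hG' using fun k => PolyCode.exists_monicPoly_eq (H.monic k)
    choose w' hw' hw'' using fun j => PolyCode.exists_reducedTest (G := G) (f := w j)
      fun k => by rw [hG]; exact H.reduced j k
    choose h' hh' _ using fun r k => PolyCode.exists_toPoly_eq (h r k)
    have hlen : (G i).length = 1 := by rw [hG, H.eq_X_sub_C, Polynomial.natDegree_X_sub_C]
    have hs : (G i).getD 0 0 = s := by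
      have := hG' i
      rw [H.eq_X_sub_C, PolyCode.monicPoly, hlen] at this
      simpa [sub_eq_add_neg] using this
    refine ⟨((P, G), (List.ofFn w', List.ofFn h'), j, e), ?_, hlen, fun r => ?_, fun j => ?_,
      j.2, ?_⟩
    · rw [hs]
      exact H.mem_of_mul_mem
    · convert H.relation r using 2
      · exact Finset.sum_congr rfl fun j _ => by simp [hw']
      · exact Finset.sum_congr rfl fun k _ => by simp [hh', hG']
    · simpa using hw'' j
    · have h1 : (List.ofFn w').getD j [] = w' j := by simp
      have h2 : Finsupp.equivFunOnFinite.symm (e : Fin (n + 1) → ℕ) = e := by ext; rfl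
      change ((List.ofFn w').getD j []).toPoly.coeff (Finsupp.equivFunOnFinite.symm e) ∉ _
      rwa [h1, h2, hw']

/-- Decidability of the vanishing of the localization at the `i`-th variable. -/
theorem exists_computable_chart_test [Primcodable B] [IsNoetherianRing B] (hB : IsComputableRing B)
    (n : ℕ) (i : Fin (n + 1)) :
    ∃ f : PresentationCode B n → Bool, Computable f ∧
      ∀ c, c.IsHomogeneous → (f c = true ↔ ∀ j, ∃ N : ℕ,
        (Pi.single j (MvPolynomial.X i ^ N) : Fin c.1.length → MvPolynomial (Fin (n + 1)) B) ∈
          Submodule.span (MvPolynomial (Fin (n + 1)) B) (Set.range c.mat)) := by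
  obtain ⟨mem, hmem, mem_iff⟩ := hB.exists_membership_test
  obtain ⟨nzd, hnzd, nzd_iff⟩ := hB.exists_nonZeroDivisor_test
  let T₁ := ℕ × (ℕ × (Fin (n + 1) → ℕ)) × (ℕ × (Fin (n + 1) → ℕ))
  let T₂ := ℕ × List (List (PolyCode B n))
  -- Inhomogeneity counts as a positive hit only to make the search total on all codes. The negative
  -- test is sound even without homogeneity.
  have hpos : Computable₂ fun (c : PresentationCode B n) (t : T₁ ⊕ T₂) =>
      (Sum.casesOn t (fun t => inhomogeneityTest mem c t) (fun t => powerTest mem i c t) : Bool) :=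
    Computable.sumCasesOn Computable.snd
      ((computable_inhomogeneityTest hB hmem).comp
        (Computable.fst.comp Computable.fst) Computable.snd).to₂
      ((computable_powerTest hB hmem i).comp
        (Computable.fst.comp Computable.fst) Computable.snd).to₂
  have hneg := computable_certificateTest (n := n) hB hmem hnzd i
  have hcert : ∀ c : PresentationCode B n, (∃ t, certificateTest mem nzd i c t = true) →
      ∃ j, ∀ N : ℕ,
        (Pi.single j (MvPolynomial.X i ^ N) : Fin c.1.length → MvPolynomial (Fin (n + 1)) B) ∉
          Submodule.span (MvPolynomial (Fin (n + 1)) B) (Set.range c.mat) := by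
    intro c ht
    obtain ⟨I, s, g, w, h, H⟩ := (exists_certificateTest_iff mem_iff nzd_iff i c).1 ht
    exact H.exists_forall_pow_notMem
  obtain ⟨f, hf, hf'⟩ := exists_computable_decision hpos hneg fun c => by
    by_cases hc : c.IsHomogeneous
    · by_cases hp : ∃ t, powerTest mem i c t = true
      · obtain ⟨t, ht⟩ := hp
        exact Or.inl ⟨Sum.inr t, ht⟩
      · rw [exists_powerTest_iff mem_iff] at hp
        push Not at hp
        obtain ⟨j, hj⟩ := hp
        exact Or.inr ((exists_certificateTest_iff mem_iff nzd_iff i c).2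
          (MvPolynomial.exists_isNonvanishingCertificate (a := c.deg) hc hj))
    · obtain ⟨t, ht⟩ := (exists_inhomogeneityTest_iff mem_iff c).2 hc
      exact Or.inl ⟨Sum.inl t, ht⟩
  refine ⟨f, hf, fun c hc => ⟨fun h => ?_, fun h => ?_⟩⟩
  · obtain ⟨t | t, ht⟩ := (hf' c).1 h
    · exact absurd hc ((exists_inhomogeneityTest_iff mem_iff c).1 ⟨t, ht⟩)
    · exact (exists_powerTest_iff mem_iff i c).1 ⟨t, ht⟩
  · by_contra hfc
    obtain ⟨j, hj⟩ := hcert c ((hf' c).2 (Bool.eq_false_iff.2 hfc))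
    obtain ⟨N, hN⟩ := h j
    exact hj N hN

end PresentationCode

/-! ### Charts and quasi-zero modules in terms of generators. -/

section GradedModule

variable {B : Type*} [CommRing B] {n : ℕ} {M : Type*} [AddCommGroup M]
  [Module (MvPolynomial (Fin (n + 1)) B) M] {ℳ : ℤ → AddSubgroup M}

theorem smul_eq_zero_of_span_eq_top {ι : Type*} {f : MvPolynomial (Fin (n + 1)) B}
    {g : ι → M} (hg : Submodule.span (MvPolynomial (Fin (n + 1)) B) (Set.range g) = ⊤)
    (hf : ∀ j, f • g j = 0) (m : M) : f • m = 0 := by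
  have hm : m ∈ Submodule.span (MvPolynomial (Fin (n + 1)) B) (Set.range g) := hg ▸ trivial
  induction hm using Submodule.span_induction with
  | mem m hm => obtain ⟨j, rfl⟩ := hm; exact hf j
  | zero => exact smul_zero f
  | add m m' _ _ h h' => rw [smul_add, h, h', add_zero]
  | smul a m _ h => rw [smul_comm, h, smul_zero]

theorem exists_forall_pow_smul_eq_zero {ι : Type*} [Fintype ι] {f : MvPolynomial (Fin (n + 1)) B}
    {g : ι → M} (h : ∀ j, ∃ N : ℕ, f ^ N • g j = 0) : ∃ N : ℕ, ∀ j, f ^ N • g j = 0 := by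
  choose N hN using h
  refine ⟨∑ j, N j, fun j => ?_⟩
  have hle := Finset.single_le_sum (f := N) (fun _ _ => Nat.zero_le _) (Finset.mem_univ j)
  rw [← Nat.sub_add_cancel hle, pow_add, mul_smul, hN, smul_zero]

theorem chart_eq_bot_iff (h : IsGradedModule (B := B) (n := n) ℳ) (i : Fin (n + 1))
    {ι : Type*} [Fintype ι] {g : ι → M} {a : ι → ℤ} (hga : ∀ j, g j ∈ ℳ (a j))
    (hg : Submodule.span (MvPolynomial (Fin (n + 1)) B) (Set.range g) = ⊤) :
    chart h i = ⊥ ↔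
      ∀ j, ∃ N : ℕ, (MvPolynomial.X i ^ N : MvPolynomial (Fin (n + 1)) B) • g j = 0 := by
  constructor
  · intro H j
    -- Elements of `chart` have numerators of degree in `ℕ`, so `g j / X i ^ a j` is expanded by `X
    -- i ^ l` to reach a nonnegative degree.
    let l := (a j).natAbs
    have hmem := h.smul_mem l _ (a j) (g j) (MvPolynomial.isHomogeneous_X_pow i l) (hga j)
    have hk : a j + l = ((a j + l).toNat : ℕ) := by omega
    rw [hk] at hmem
    have hz : LocalizedModule.mk ((MvPolynomial.X i ^ l : MvPolynomial (Fin (n + 1)) B) • g j)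
        ⟨MvPolynomial.X i ^ (a j + l).toNat,
          Submonoid.pow_mem _ (Submonoid.mem_powers _) _⟩ ∈ chart h i :=
      ⟨_, _, hmem, rfl⟩
    rw [H, AddSubgroup.mem_bot, ← LocalizedModule.zero_mk 1, LocalizedModule.mk_eq] at hz
    obtain ⟨⟨_, N, rfl⟩, hN⟩ := hz
    refine ⟨N + l, ?_⟩
    rw [smul_zero, smul_zero, one_smul] at hN
    rw [pow_add, mul_smul]
    exact hN
  · intro H
    obtain ⟨N, hN⟩ := exists_forall_pow_smul_eq_zero H
    rw [eq_bot_iff]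
    rintro _ ⟨k, m, -, rfl⟩
    rw [AddSubgroup.mem_bot, ← LocalizedModule.zero_mk 1, LocalizedModule.mk_eq]
    refine ⟨⟨_, N, rfl⟩, ?_⟩
    rw [smul_zero, smul_zero, one_smul]
    exact smul_eq_zero_of_span_eq_top hg hN m

theorem isQuasiZero_iff (h : IsGradedModule (B := B) (n := n) ℳ)
    {ι : Type*} [Fintype ι] {g : ι → M} {a : ι → ℤ} (hga : ∀ j, g j ∈ ℳ (a j))
    (hg : Submodule.span (MvPolynomial (Fin (n + 1)) B) (Set.range g) = ⊤) :
    IsQuasiZero ℳ ↔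
      ∀ i j, ∃ N : ℕ, (MvPolynomial.X i ^ N : MvPolynomial (Fin (n + 1)) B) • g j = 0 := by
  constructor
  · rintro ⟨d₀, hd₀⟩ i j
    let N := (d₀ - a j).toNat
    have hmem := h.smul_mem N _ (a j) (g j) (MvPolynomial.isHomogeneous_X_pow i N) (hga j)
    rw [hd₀ _ (by omega), AddSubgroup.mem_bot] at hmem
    exact ⟨N, hmem⟩
  · intro H
    choose N hN using fun i => exists_forall_pow_smul_eq_zero (H i)
    -- Pigeonhole: a monomial of degree at least `∑ N i` contains some `X i ^ N i` and kills all
    -- generators. The term `∑ |a j|` bounds the generator degrees.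
    refine ⟨∑ j, |a j| + ∑ i, (N i : ℤ), fun d hd => ?_⟩
    have hle : ∀ j, a j ≤ ∑ j, |a j| := fun j =>
      (le_abs_self _).trans
        (Finset.single_le_sum (f := fun j => |a j|) (fun _ _ => abs_nonneg _) (Finset.mem_univ j))
    have hmon : ∀ (e : Fin (n + 1) →₀ ℕ) (b : B) (j : ι),
        MvPolynomial.monomial e b • g j ∈ ⨆ (d' : ℤ) (_ : d' ≠ d), ℳ d' := by
      intro e b j
      by_cases he : ∃ i, N i ≤ e i
      · obtain ⟨i, hi⟩ := he
        have : MvPolynomial.monomial e b =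
            MvPolynomial.monomial (e - Finsupp.single i (N i)) b * MvPolynomial.X i ^ N i := by
          rw [MvPolynomial.X_pow_eq_monomial, MvPolynomial.monomial_mul, mul_one,
            tsub_add_cancel_of_le (Finsupp.single_le_iff.2 hi)]
        rw [this, mul_smul, hN, smul_zero]
        exact AddSubgroup.zero_mem _
      · push Not at he
        have hlt : ∑ i, e i < ∑ i, N i :=
          Finset.sum_lt_sum_of_nonempty Finset.univ_nonempty fun i _ => he i
        have hmem := h.smul_mem (∑ i, e i) _ (a j) (g j) (MvPolynomial.isHomogeneous_monomial b
          (Finsupp.degree_eq_sum e)) (hga j)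
        refine AddSubgroup.mem_iSup_of_mem (a j + (∑ i, e i : ℕ))
          (AddSubgroup.mem_iSup_of_mem ?_ hmem)
        have := hle j
        have h2 : ((∑ i, e i : ℕ) : ℤ) < ∑ i, (N i : ℤ) := by exact_mod_cast hlt
        omega
    -- For large `d` the components of degree other than `d` already span `M`; independence of the
    -- grading then forces `ℳ d` to vanish.
    have htop : ∀ m : M, m ∈ ⨆ (d' : ℤ) (_ : d' ≠ d), ℳ d' := by
      intro m
      have hm : m ∈ Submodule.span (MvPolynomial (Fin (n + 1)) B) (Set.range g) := hg ▸ trivial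
      obtain ⟨f, rfl⟩ := (Submodule.mem_span_range_iff_exists_fun _).1 hm
      refine AddSubgroup.sum_mem _ fun j _ => ?_
      rw [(f j).as_sum, Finset.sum_smul]
      exact AddSubgroup.sum_mem _ fun e _ => hmon e _ j
    have hind := h.isInternal.addSubgroup_iSupIndep d
    rw [eq_bot_iff]
    exact fun m hm => (AddSubgroup.mem_bot).2
      (by simpa using AddSubgroup.disjoint_def.1 hind hm (htop m))

end GradedModule

/-! ### The decision procedure. -/

theorem lemma4p5 {B : Type*} [CommRing B] [Primcodable B] [IsNoetherianRing B]
    (hB : IsComputableRing B) (hT : HasEffectiveCosetReps B) (n : ℕ) :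
    ∃ (test : PresentationCode B n → Bool)
      (chartTest : Fin (n + 1) → PresentationCode B n → Bool),
      Computable test ∧ Computable₂ chartTest ∧
      (∀ c, test c = true ↔ ∀ i, chartTest i c = true) ∧
      ∀ (M : Type*) [AddCommGroup M] [Module (MvPolynomial (Fin (n + 1)) B) M]
        (ℳ : ℤ → AddSubgroup M) (h : IsGradedModule (B := B) (n := n) ℳ)
        (c : PresentationCode B n), IsPresentedBy ℳ c →
        (test c = true ↔ IsQuasiZero ℳ) ∧
        (∀ i, chartTest i c = true ↔ chart h i = ⊥) ∧
        (IsQuasiZero ℳ ↔ ∀ i, chart h i = ⊥) := by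
  choose f hf hf' using PresentationCode.exists_computable_chart_test hB n
  have htest : ∀ c, (List.finRange (n + 1)).all (fun i => f i c) = true ↔ ∀ i, f i c = true :=
    fun c => by simp
  refine ⟨fun c => (List.finRange (n + 1)).all fun i => f i c, f,
    Computable.list_const_all _ hf, ?_, htest, ?_⟩
  -- Joint computability in `i` and `c` follows by tabulating the finitely many tests and looking up
  -- the `i`-th result.
  · have h1 : Computable fun c : PresentationCode B n => List.Vector.ofFn fun i => f i c :=
      Computable.vector_ofFn hf
    exact (Computable.vector_get.comp (h1.comp Computable.snd) Computable.fst).of_eq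
      fun a => by rw [List.Vector.get_ofFn]
  · rintro M _ _ ℳ h c ⟨hc, g, hga, hg, hrel⟩
    have hpow : ∀ (i : Fin (n + 1)) (j : Fin c.1.length) (N : ℕ),
        (MvPolynomial.X i ^ N : MvPolynomial (Fin (n + 1)) B) • g j = 0 ↔
        (Pi.single j (MvPolynomial.X i ^ N) : Fin c.1.length → MvPolynomial (Fin (n + 1)) B) ∈
          Submodule.span (MvPolynomial (Fin (n + 1)) B) (Set.range c.mat) := by
      intro i j N
      rw [← hrel, Finset.sum_eq_single j (fun k _ hk => by simp [hk]) (by simp), Pi.single_eq_same]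
    have hchart : ∀ i, f i c = true ↔ chart h i = ⊥ := by
      intro i
      rw [hf' i c hc, chart_eq_bot_iff h i hga hg]
      simp only [hpow]
    have hqz : IsQuasiZero ℳ ↔ ∀ i, chart h i = ⊥ := by
      rw [isQuasiZero_iff h hga hg]
      exact forall_congr' fun i => (chart_eq_bot_iff h i hga hg).symm
    refine ⟨?_, hchart, hqz⟩
    rw [htest, hqz]
    exact forall_congr' hchart
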